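/- Let $d\ge 0$, let $K_0(\mathcal V_{\mathbb C})$ be the Grothendieck ring of complex quasi-projective varieties, $\mathbb L$ the class of the affine line, and $R=K_0(\mathcal V_{\mathbb C})[\mathbb L^{-1}]$. Let $\mathcal L_0$ be the space of arcs $\varphi:(\mathbb C,0)\to(\mathbb C^d,0)$ (germs of holomorphic maps) and $\mathcal L_0^n\cong\mathbb C^{dn}$ the space of their $n$-jets ($n\ge0$). The group $\mathbb C^*$ acts on both by $(a*\varphi)(\tau)=\varphi(a\tau)$. Put $\mathcal L_0^*=\mathcal L_0\setminus\{0\}$, $\mathcal L_0^{n*}=\mathcal L_0^n\setminus\{0\}$; the quotient $\mathcal L_0^{n*}/\mathbb C^*$ is a (weighted projective) variety. Let $p:\mathcal L_0^*\to\mathcal L_0^*/\mathbb C^*$ be the factorization map, and let $\pi_n:\mathcal L_0\to\mathcal L_0^n$ and $\pi_n:\mathcal L_0^*/\mathbb C^*\to(\mathcal L_0^{n*}/\mathbb C^*)\cup\{0\}$ be the truncation maps. A subset $X$ of $\mathcal L_0^*/\mathbb C^*$ (respectively of $\mathcal L_0$) is called constructible (cylindric) if $X=\pi_n^{-1}(Y)$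 for some $n\ge 0$ and some constructible subset $Y$ of $\mathcal L_0^{n*}/\mathbb C^*$ (respectively of $\mathcal L_0^n$); its motivic measure is $\chi_g(X)=[Y]\cdot\mathbb L^{-dn}\in R$. A function $\psi$ on one of these two spaces with values in an abelian group $G$ is called constructible if it has countably many values and $\psi^{-1}(a)$ is constructible for each $a\in G$, $a\ne0$. Fix an $R$-module $M$ with a topology for which multiplication by each element of $R$ is continuous, and a homomorphism of abelian groups $\iota:G\to M$. A constructible function $\psi$ is called integrable if the series $\sum_{a\in G,\,a\neq 0}\chi_g(\psi^{-1}(a))\cdot \iota(a)$ converges unconditionally in $M$, and its integral $\int\psi\,d\chi_g$ is the sum of this series. Let $\psi:\mathcal L_0^*/\mathbb C^*\to G$ be a constructible integrable function and let $\widetilde\psi=\psi\circ p:\mathcal L_0^*\to G$ be the corresponding $\mathbb C^*$-invariant function, extended by zero to $\mathcal L_0$. Then $\widetilde\psi$ is (constructible and) integrable, and $$\int_{\mathcal L_0}\widetilde\psi\,d\chi_g=(\mathbb L-1)\int_{\mathcal L_0^*/\mathbb C^*}\psi\,d\chi_g .$$ (If $M$ is not Hausdorff, this means: for every sum $I$ of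 the series of $\psi$, $(\mathbb L-1)I$ is a sum of the series of $\widetilde\psi$.) -/

import Mathlib

noncomputable section

namespace MotivicArcs

open scoped Topology LinearAlgebra.Projectivization

/-! ## Spaces with regular functions and quasi-projective varieties -/

/-- A space with regular functions: a topological space together with the notion of a complex
function being regular at a point (i.e. regular on some open neighbourhood of the point).
The two laws say that regularity depends only on the germ and is an open condition. -/
structure FunSpace where
  carrier : Type
  top : TopologicalSpace carrier
  RegularAt : (carrier → ℂ) → carrier → Prop
  regularAt_congr : ∀ (f g : carrier → ℂ) (x : carrier),
    (∀ᶠ y in @nhds carrier top x, f y = g y) → RegularAt f x → RegularAt g x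
  eventually_regularAt : ∀ (f : carrier → ℂ) (x : carrier),
    RegularAt f x → ∀ᶠ y in @nhds carrier top x, RegularAt f y

namespace FunSpace

instance : CoeSort FunSpace Type := ⟨FunSpace.carrier⟩

instance (X : FunSpace) : TopologicalSpace X := X.top

/-- A morphism: a continuous map that pulls regular functions back to regular functions. -/
def IsMorphism {X Y : FunSpace} (φ : X → Y) : Prop :=
  Continuous φ ∧
    ∀ (f : Y → ℂ) (x : X), Y.RegularAt f (φ x) → X.RegularAt (fun z => f (φ z)) x

/-- Two spaces with regular functions are isomorphic. -/
def Isomorphic (X Y : FunSpace) : Prop :=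
  ∃ e : X.carrier ≃ Y.carrier,
    IsMorphism (X := X) (Y := Y) e ∧ IsMorphism (X := Y) (Y := X) e.symm

/-- The Zariski topology on affine space: the sets `{p ≠ 0}`, for polynomials `p`, form a basis. -/
@[reducible] def zariski (σ : Type) : TopologicalSpace (σ → ℂ) :=
  TopologicalSpace.generateFrom
    {U | ∃ p : MvPolynomial σ ℂ, U = {x | MvPolynomial.eval x p ≠ 0}}

/-- Affine space with coordinates indexed by `σ`: the Zariski topology, and the functions that
are locally quotients of polynomials. -/
def affine (σ : Type) : FunSpace where
  carrier := σ → ℂ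
  top := zariski σ
  RegularAt f x := ∃ p q : MvPolynomial σ ℂ, MvPolynomial.eval x q ≠ 0 ∧
    ∀ᶠ y in @nhds (σ → ℂ) (zariski σ) x, f y = MvPolynomial.eval y p / MvPolynomial.eval y q
  regularAt_congr := by
    rintro f g x hfg ⟨p, q, hq, h⟩
    refine ⟨p, q, hq, ?_⟩
    filter_upwards [hfg, h] with y h1 h2
    rw [← h1, h2]
  eventually_regularAt := by
    let _ : TopologicalSpace (σ → ℂ) := zariski σ
    rintro f x ⟨p, q, hq, h⟩
    have hopen : IsOpen[zariski σ] {y : σ → ℂ | MvPolynomial.eval y q ≠ 0} :=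
      TopologicalSpace.isOpen_generateFrom_of_mem ⟨q, rfl⟩
    have h1 : ∀ᶠ y in @nhds (σ → ℂ) (zariski σ) x, MvPolynomial.eval y q ≠ 0 :=
      hopen.mem_nhds hq
    filter_upwards [eventually_eventually_nhds.2 h, h1] with y h2 h3
    exact ⟨p, q, h3, h2⟩

/-- The structure induced on a subset: a function is regular at a point if, near that point, it is
the restriction of a regular function of the ambient space. -/
def restrict (X : FunSpace) (S : Set X) : FunSpace where
  carrier := S
  top := instTopologicalSpaceSubtype
  RegularAt f x := ∃ F : X → ℂ, X.RegularAt F x ∧ ∀ᶠ y in 𝓝 x, f y = F y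
  regularAt_congr := by
    rintro f g x hfg ⟨F, hF, h⟩
    refine ⟨F, hF, ?_⟩
    filter_upwards [hfg, h] with y h1 h2
    rw [← h1, h2]
  eventually_regularAt := by
    rintro f x ⟨F, hF, h⟩
    have h1 : ∀ᶠ y : S in 𝓝 x, X.RegularAt F y :=
      continuous_subtype_val.continuousAt.eventually (X.eventually_regularAt F x hF)
    filter_upwards [eventually_eventually_nhds.2 h, h1] with y h2 h3
    exact ⟨F, h3, h2⟩

/-- The structure on a quotient `q : X → W`: the quotient topology, and the functions whose
pull-backs to `X` are regular. -/
def coinduced (X : FunSpace) {W : Type} (q : X → W) : FunSpace where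
  carrier := W
  top := TopologicalSpace.coinduced q X.top
  RegularAt f w := ∀ᶠ z in @nhds W (TopologicalSpace.coinduced q X.top) w,
    ∀ x, q x = z → X.RegularAt (fun y => f (q y)) x
  regularAt_congr := by
    let _ : TopologicalSpace W := TopologicalSpace.coinduced q X.top
    have hq : Continuous q := continuous_coinduced_rng
    intro f g w hfg h
    filter_upwards [eventually_eventually_nhds.2 hfg, h] with z h1 h2 x hx
    refine X.regularAt_congr _ _ x ?_ (h2 x hx)
    subst hx
    exact hq.continuousAt.eventually h1
  eventually_regularAt := by
    let _ : TopologicalSpace W := TopologicalSpace.coinduced q X.top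
    intro f w h
    exact eventually_eventually_nhds.2 h

end FunSpace

open FunSpace

/-- Complex projective space of dimension `n`, as the quotient of the punctured affine space. -/
def projSpace (n : ℕ) : FunSpace :=
  coinduced (restrict (affine (Fin (n + 1))) {v : Fin (n + 1) → ℂ | v ≠ 0})
    (W := ℙ ℂ (Fin (n + 1) → ℂ))
    (fun v : {v : Fin (n + 1) → ℂ // v ≠ 0} => Projectivization.mk' ℂ v)

/-- A complex quasi-projective variety (not necessarily irreducible): a locally closed subset of
a projective space. -/
structure QPVar where
  dim : ℕ
  set : Set (projSpace dim)
  isLocallyClosed : IsLocallyClosed set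

/-- A quasi-projective variety as a space with regular functions. -/
def QPVar.toSpace (X : QPVar) : FunSpace := restrict (projSpace X.dim) X.set

/-- `P` is a product of `X` and `Y` in the category of quasi-projective varieties. -/
def IsProduct (X Y P : QPVar) : Prop :=
  ∃ (p₁ : P.toSpace → X.toSpace) (p₂ : P.toSpace → Y.toSpace),
    IsMorphism p₁ ∧ IsMorphism p₂ ∧
    ∀ (T : QPVar) (f : T.toSpace → X.toSpace) (g : T.toSpace → Y.toSpace),
      IsMorphism f → IsMorphism g →
        ∃! h : T.toSpace → P.toSpace, IsMorphism h ∧ p₁ ∘ h = f ∧ p₂ ∘ h = g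

/-! ## The Grothendieck ring of complex quasi-projective varieties -/

/-- The relations of the Grothendieck ring, among polynomials in the symbols of the varieties. -/
inductive K0Relation : MvPolynomial QPVar ℤ → Prop
  /-- isomorphic varieties have the same class -/
  | iso (X Y : QPVar) (h : Isomorphic X.toSpace Y.toSpace) :
      K0Relation (MvPolynomial.X X - MvPolynomial.X Y)
  /-- `[X] = [X ∩ A] + [X \ A]` for `A` Zariski closed -/
  | scissor (X : QPVar) (A : Set (projSpace X.dim)) (hA : IsClosed A) :
      K0Relation (MvPolynomial.X X
        - (MvPolynomial.X ⟨X.dim, X.set ∩ A, X.isLocallyClosed.inter hA.isLocallyClosed⟩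
          + MvPolynomial.X ⟨X.dim, X.set ∩ Aᶜ,
              X.isLocallyClosed.inter hA.isOpen_compl.isLocallyClosed⟩))
  /-- the product of classes is the class of the Cartesian product -/
  | prod (X Y P : QPVar) (h : IsProduct X Y P) :
      K0Relation (MvPolynomial.X P - MvPolynomial.X X * MvPolynomial.X Y)
  /-- the class of a point is the unit -/
  | point (X : QPVar) (h : ∃! x, x ∈ X.set) :
      K0Relation (MvPolynomial.X X - 1)

/-- The Grothendieck ring `K₀(𝒱_ℂ)` of complex quasi-projective varieties. -/
abbrev K0 : Type := MvPolynomial QPVar ℤ ⧸ Ideal.span {r | K0Relation r}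

/-- The class of a quasi-projective variety. -/
def varClass (X : QPVar) : K0 := Ideal.Quotient.mk _ (MvPolynomial.X X)

/-- `S` is a disjoint union of finitely many locally closed subsets of `X` that are
quasi-projective varieties, and `c` is the sum of their classes. -/
def HasClass (X : FunSpace) (S : Set X) (c : K0) : Prop :=
  ∃ (k : ℕ) (A : Fin k → Set X) (Q : Fin k → QPVar),
    (∀ i, IsLocallyClosed (A i)) ∧ (∀ i j, i ≠ j → Disjoint (A i) (A j)) ∧
    S = ⋃ i, A i ∧ (∀ i, Isomorphic (restrict X (A i)) (Q i).toSpace) ∧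
    c = ∑ i, varClass (Q i)

open scoped Classical in
/-- The class `[S]` in the Grothendieck ring of a constructible set `S`; it does not depend on the
partition into varieties. -/
def cls (X : FunSpace) (S : Set X) : K0 :=
  if h : ∃ c, HasClass X S c then h.choose else 0

/-- The class of the affine line in the Grothendieck ring. -/
def lefschetz : K0 := cls (affine (Fin 1)) Set.univ

/-- The localization `K₀(𝒱_ℂ)[𝕃⁻¹]`. -/
abbrev K0Loc : Type := Localization.Away lefschetz

/-- The class of the affine line in the localized Grothendieck ring. -/
def LL : K0Loc := algebraMap K0 K0Loc lefschetz

/-- The fraction `c · 𝕃⁻ᵏ`. -/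
def overLPow (c : K0) (k : ℕ) : K0Loc :=
  Localization.mk c ⟨lefschetz ^ k, ⟨k, rfl⟩⟩

/-! ## Arcs and jets -/

/-- A power series with positive radius of convergence, i.e. a germ at `0` of a holomorphic
function of one variable. -/
def IsConvergent (f : PowerSeries ℂ) : Prop :=
  ∃ r : ℝ, 0 < r ∧ Summable fun k => ‖PowerSeries.coeff k f‖ * r ^ k

/-- The space `ℒ₀` of arcs `(ℂ, 0) → (ℂ^d, 0)`. -/
def Arc (d : ℕ) : Type :=
  {φ : Fin d → PowerSeries ℂ //
    ∀ j, PowerSeries.constantCoeff (φ j) = 0 ∧ IsConvergent (φ j)}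

lemma IsConvergent.rescale {f : PowerSeries ℂ} (hf : IsConvergent f) (a : ℂˣ) :
    IsConvergent (PowerSeries.rescale (a : ℂ) f) := by
  obtain ⟨r, hr, h⟩ := hf
  have ha : 0 < ‖(a : ℂ)‖ := norm_pos_iff.2 a.ne_zero
  refine ⟨r / ‖(a : ℂ)‖, div_pos hr ha, h.congr fun k => ?_⟩
  rw [PowerSeries.coeff_rescale, norm_mul, norm_pow, div_pow]
  have : ‖(a : ℂ)‖ ^ k ≠ 0 := (pow_pos ha k).ne'
  field_simp

/-- The constant arc. -/
instance (d : ℕ) : Zero (Arc d) :=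
  ⟨⟨fun _ => 0, fun _ => ⟨map_zero _, 1, one_pos, by simp⟩⟩⟩

/-- The action of `ℂ*` on arcs, `(a * φ)(τ) = φ(aτ)`. -/
instance (d : ℕ) : MulAction ℂˣ (Arc d) where
  smul a φ := ⟨fun j => PowerSeries.rescale (a : ℂ) (φ.1 j), fun j =>
    ⟨by
      rw [← PowerSeries.coeff_zero_eq_constantCoeff_apply, PowerSeries.coeff_rescale,
        PowerSeries.coeff_zero_eq_constantCoeff_apply, (φ.2 j).1, mul_zero],
     (φ.2 j).2.rescale a⟩⟩
  one_smul φ := Subtype.ext <| funext fun j => by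
    change PowerSeries.rescale ((1 : ℂˣ) : ℂ) (φ.1 j) = φ.1 j
    simp
  mul_smul a b φ := Subtype.ext <| funext fun j => by
    change PowerSeries.rescale ((a * b : ℂˣ) : ℂ) (φ.1 j) =
      PowerSeries.rescale (a : ℂ) (PowerSeries.rescale (b : ℂ) (φ.1 j))
    ext k
    simp only [PowerSeries.coeff_rescale, Units.val_mul, mul_pow, mul_assoc]

lemma Arc.smul_zero {d : ℕ} (a : ℂˣ) : a • (0 : Arc d) = 0 :=
  Subtype.ext <| funext fun _ => map_zero (PowerSeries.rescale (a : ℂ))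

/-- The punctured space `ℒ₀* = ℒ₀ \ {0}`. -/
def ArcStar (d : ℕ) : Type := {φ : Arc d // φ ≠ 0}

instance (d : ℕ) : MulAction ℂˣ (ArcStar d) where
  smul a φ := ⟨a • φ.1, fun h => φ.2 (by
    rw [← inv_smul_smul a φ.1, h, Arc.smul_zero])⟩
  one_smul φ := Subtype.ext (one_smul ℂˣ φ.1)
  mul_smul a b φ := Subtype.ext (mul_smul a b φ.1)

/-- The space `ℒ₀*/ℂ*`. -/
abbrev ArcQuot (d : ℕ) : Type := MulAction.orbitRel.Quotient ℂˣ (ArcStar d)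

/-- The factorization map `p : ℒ₀* → ℒ₀*/ℂ*`. -/
def arcProj {d : ℕ} (φ : ArcStar d) : ArcQuot d := Quotient.mk _ φ

/-- The space `ℒ₀ⁿ` of `n`-jets of arcs: the entry with index `(k, j)` is the coefficient of
`τ ^ (k + 1)` in the `j`-th component. -/
def Jet (d n : ℕ) : Type := Fin n × Fin d → ℂ

instance (d n : ℕ) : Zero (Jet d n) := ⟨fun _ => 0⟩

/-- The action of `ℂ*` on jets, `(a * φ)(τ) = φ(aτ)`. -/
instance (d n : ℕ) : MulAction ℂˣ (Jet d n) where
  smul a c := fun i => (a : ℂ) ^ ((i.1 : ℕ) + 1) * c i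
  one_smul c := funext fun i => by
    change ((1 : ℂˣ) : ℂ) ^ ((i.1 : ℕ) + 1) * c i = c i
    simp
  mul_smul a b c := funext fun i => by
    change ((a * b : ℂˣ) : ℂ) ^ ((i.1 : ℕ) + 1) * c i =
      (a : ℂ) ^ ((i.1 : ℕ) + 1) * ((b : ℂ) ^ ((i.1 : ℕ) + 1) * c i)
    rw [Units.val_mul, mul_pow, mul_assoc]

lemma Jet.smul_zero {d n : ℕ} (a : ℂˣ) : a • (0 : Jet d n) = 0 :=
  funext fun _ => mul_zero _

lemma Jet.smul_eq_zero {d n : ℕ} {a : ℂˣ} {c : Jet d n} : a • c = 0 ↔ c = 0 := by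
  refine ⟨fun h => ?_, fun h => by rw [h, Jet.smul_zero]⟩
  rw [← inv_smul_smul a c, h, Jet.smul_zero]

/-- The punctured jet space. -/
def JetStar (d n : ℕ) : Type := {c : Jet d n // c ≠ 0}

instance (d n : ℕ) : MulAction ℂˣ (JetStar d n) where
  smul a c := ⟨a • c.1, fun h => c.2 (Jet.smul_eq_zero.1 h)⟩
  one_smul c := Subtype.ext (one_smul ℂˣ c.1)
  mul_smul a b c := Subtype.ext (mul_smul a b c.1)

/-- The factor space of the punctured jet space by `ℂ*`. -/
abbrev JetQuot (d n : ℕ) : Type := MulAction.orbitRel.Quotient ℂˣ (JetStar d n)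

/-- The jet space as an affine space. -/
def jetSpace (d n : ℕ) : FunSpace := affine (Fin n × Fin d)

/-- The factor space of the punctured jet space by `ℂ*`, as a variety (a weighted projective
space). -/
def jetQuotSpace (d n : ℕ) : FunSpace :=
  coinduced (restrict (jetSpace d n) {c : Jet d n | c ≠ 0})
    (W := JetQuot d n) (fun c : JetStar d n => Quotient.mk _ c)

/-- The truncation `ℒ₀ → ℒ₀ⁿ`. -/
def jet {d : ℕ} (n : ℕ) (φ : Arc d) : Jet d n :=
  fun i => PowerSeries.coeff ((i.1 : ℕ) + 1) (φ.1 i.2)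

lemma jet_smul {d : ℕ} (n : ℕ) (a : ℂˣ) (φ : Arc d) : jet n (a • φ) = a • jet n φ :=
  funext fun _ => PowerSeries.coeff_rescale _ _ _

open scoped Classical in
/-- The map `π_n : ℒ₀*/ℂ* → (ℒ₀ⁿ*/ℂ*) ∪ {0}`; the added point `0` is `none`. -/
def piQuot {d : ℕ} (n : ℕ) : ArcQuot d → Option (JetQuot d n) :=
  Quotient.lift
    (fun φ : ArcStar d =>
      if h : jet n φ.1 ≠ 0 then some (Quotient.mk _ (⟨jet n φ.1, h⟩ : JetStar d n)) else none)
    (by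
      rintro φ φ' ⟨a, rfl⟩
      have hj : jet n (a • φ').1 = a • jet n φ'.1 := jet_smul n a φ'.1
      by_cases h : jet n φ'.1 = 0
      · have h' : jet n (a • φ').1 = 0 := by rw [hj, h, Jet.smul_zero]
        simp [h, h']
      · have h' : jet n (a • φ').1 ≠ 0 := by rwa [hj, Ne, Jet.smul_eq_zero]
        simp only [ne_eq, h, h', not_false_eq_true, dite_true]
        exact congrArg some (Quotient.sound ⟨a, Subtype.ext hj.symm⟩))

/-! ## Motivic measures -/

/-- `X = π_n⁻¹(Y)` for some `n` and some constructible `Y` in the `n`-jets modulo `ℂ*`, and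
`v = [Y] · 𝕃^(-dn)`. -/
def HasMeasureQuot {d : ℕ} (X : Set (ArcQuot d)) (v : K0Loc) : Prop :=
  ∃ (n : ℕ) (Y : Set (jetQuotSpace d n)), Topology.IsConstructible Y ∧
    X = {x | ∃ y ∈ Y, piQuot n x = some y} ∧ v = overLPow (cls (jetQuotSpace d n) Y) (d * n)

/-- `X = π_n⁻¹(Y)` for some `n` and some constructible set `Y` of `n`-jets, and
`v = [Y] · 𝕃^(-dn)`. -/
def HasMeasureArc {d : ℕ} (X : Set (Arc d)) (v : K0Loc) : Prop :=
  ∃ (n : ℕ) (Y : Set (jetSpace d n)), Topology.IsConstructible Y ∧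
    X = {φ | jet n φ ∈ Y} ∧ v = overLPow (cls (jetSpace d n) Y) (d * n)

/-- Cylindric (constructible) subsets of `ℒ₀*/ℂ*`. -/
def IsCylindricQuot {d : ℕ} (X : Set (ArcQuot d)) : Prop := ∃ v, HasMeasureQuot X v

/-- Cylindric (constructible) subsets of `ℒ₀`. -/
def IsCylindricArc {d : ℕ} (X : Set (Arc d)) : Prop := ∃ v, HasMeasureArc X v

open scoped Classical in
/-- The motivic measure on `ℒ₀*/ℂ*`; the value does not depend on the presentation of `X`. -/
def chiQuot {d : ℕ} (X : Set (ArcQuot d)) : K0Loc :=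
  if h : ∃ v, HasMeasureQuot X v then h.choose else 0

open scoped Classical in
/-- The motivic measure on `ℒ₀`; the value does not depend on the presentation of `X`. -/
def chiArc {d : ℕ} (X : Set (Arc d)) : K0Loc :=
  if h : ∃ v, HasMeasureArc X v then h.choose else 0

/-! ## Integration -/

section Integration

variable {Ω G M : Type*} [AddCommGroup G] [AddCommGroup M] [Module K0Loc M] [TopologicalSpace M]

/-- A function is constructible if it has countably many values and its level sets of nonzero
values are constructible. -/
def IsConstructibleFun (cyl : Set Ω → Prop) (ψ : Ω → G) : Prop :=
  (Set.range ψ).Countable ∧ ∀ a : G, a ≠ 0 → cyl (ψ ⁻¹' {a})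

/-- `I` is the sum of the series `∑_{a ≠ 0} χ(ψ⁻¹(a)) · a`. The products `χ · a` and the sum are
formed in `M`, where the values of `ψ` are placed by `ι : G → M`. -/
def HasIntegral (χ : Set Ω → K0Loc) (ι : G →+ M) (ψ : Ω → G) (I : M) : Prop :=
  HasSum (fun a : {a : G // a ≠ 0} => χ (ψ ⁻¹' {a.1}) • ι a.1) I

/-- A constructible function on `ℒ₀*/ℂ*` is integrable if the series of its integral has a sum. -/
def IntegrableQuot {d : ℕ} (ι : G →+ M) (ψ : ArcQuot d → G) : Prop :=
  IsConstructibleFun IsCylindricQuot ψ ∧ ∃ I, HasIntegral chiQuot ι ψ I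

/-- A constructible function on `ℒ₀` is integrable if the series of its integral has a sum. -/
def IntegrableArc {d : ℕ} (ι : G →+ M) (ψ : Arc d → G) : Prop :=
  IsConstructibleFun IsCylindricArc ψ ∧ ∃ I, HasIntegral chiArc ι ψ I

end Integration

open scoped Classical in
/-- The `ℂ*`-invariant lift `ψ ∘ p` of `ψ` to `ℒ₀*`, regarded as a function on `ℒ₀` that is zero
outside `ℒ₀*`. -/
def lift {d : ℕ} {G : Type*} [Zero G] (ψ : ArcQuot d → G) (φ : Arc d) : G :=
  if h : φ ≠ 0 then ψ (arcProj ⟨φ, h⟩) else 0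

end MotivicArcs

end

/-! For a nonzero value the level set of the lifted function is the cone over the level set of `ψ`,
that is, its preimage under the factorization map. If the level set of `ψ` comes from a
constructible set Y of jets modulo ℂ*, the cone comes from the cone over Y in the punctured jet
space, at the same jet level n and with the same denominator 𝕃^(dn). The theorem thus reduces to
[cone over Y] = (𝕃 - 1)[Y], followed by termwise multiplication of the series by 𝕃 - 1, which is
continuous on M.

The action on jets has weights k + 1 and is not free, so the cone is trivialized stratum by stratum,
according to the support I of a jet (`HasClass.jetCone`). Let g be the gcd of the weights occurring
in I and write these weights as g·w_i. Bézout gives integers u_i with ∑ u_i w_i = 1, so the Laurent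
monomial m = ∏ x_i^(u_i) has weight exactly g. The g-th roots of unity act trivially on this
stratum, hence each orbit meets {m = 1} in exactly one point. This slice is isomorphic to the
quotient stratum (`isomorphic_slice`), and x ↦ (normalized x, m(x)) identifies the cone with slice ×
ℂ* (`isomorphic_jetCone`). The product relation and [ℂ*] = 𝕃 - 1 conclude.

The rest makes these manipulations legitimate. `cls` and `chiArc` are defined by choice with default
value 0, so existence and uniqueness of the class (`exists_hasClass_quot`, `HasClass.unique`) and
uniqueness of the measure on arcs (`HasMeasureArc.unique`) are needed. Locally closed subsets of
affine space must be realized as quasi-projective varieties, and their products must satisfy the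
universal property that the product relation demands. -/

noncomputable section

namespace MotivicArcs

open scoped Topology LinearAlgebra.Projectivization

/-! ### Regular maps and induced structures on subsets. -/

namespace FunSpace

/-- A map is regular at a point if it is continuous there and pulls functions regular at the image
back to functions regular at the point. -/
def RegularMapAt {X Y : FunSpace} (f : X → Y) (x : X) : Prop :=
  ContinuousAt f x ∧
    ∀ g : Y → ℂ, Y.RegularAt g (f x) → X.RegularAt (fun z => g (f z)) x

variable {X Y Z : FunSpace}

theorem isMorphism_iff {f : X → Y} : IsMorphism f ↔ ∀ x, RegularMapAt f x :=
  ⟨fun h x => ⟨h.1.continuousAt, fun g => h.2 g x⟩,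
    fun h => ⟨continuous_iff_continuousAt.2 fun x => (h x).1, fun g x => (h x).2 g⟩⟩

theorem RegularMapAt.comp {g : Y → Z} {f : X → Y} {x : X} (hg : RegularMapAt g (f x))
    (hf : RegularMapAt f x) : RegularMapAt (fun z => g (f z)) x :=
  ⟨ContinuousAt.comp (f := f) (g := g) hg.1 hf.1, fun k hk => hf.2 _ (hg.2 k hk)⟩

theorem IsMorphism.comp {g : Y → Z} {f : X → Y} (hg : IsMorphism g) (hf : IsMorphism f) :
    IsMorphism (fun z => g (f z)) :=
  isMorphism_iff.2 fun x => (isMorphism_iff.1 hg (f x)).comp (isMorphism_iff.1 hf x)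

theorem isMorphism_id : IsMorphism (X := X) (Y := X) (fun x => x) :=
  ⟨continuous_id, fun _ _ h => h⟩

theorem isMorphism_val {S : Set X} :
    IsMorphism (X := restrict X S) (Y := X) (fun x => x.1) :=
  ⟨continuous_subtype_val, fun g _ hg => ⟨g, hg, Filter.Eventually.of_forall fun _ => rfl⟩⟩

/-- A regular function on a subset is locally the restriction of an ambient one, so it suffices to
pull back that extension. -/
theorem RegularMapAt.codRestrict {S : Set X} {f : Z → X} (hS : ∀ z, f z ∈ S) {z : Z}
    (hf : RegularMapAt f z) :
    RegularMapAt (X := Z) (Y := restrict X S) (fun z => ⟨f z, hS z⟩) z := by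
  have hc : ContinuousAt (fun z => (⟨f z, hS z⟩ : S)) z := by
    rw [ContinuousAt, nhds_subtype_eq_comap, Filter.tendsto_comap_iff]
    exact hf.1
  refine ⟨hc, fun g hg => ?_⟩
  obtain ⟨F, hF, h⟩ := hg
  refine Z.regularAt_congr _ _ z ?_ (hf.2 F hF)
  filter_upwards [hc.eventually h] with y hy using hy.symm

theorem IsMorphism.codRestrict {S : Set X} {f : Z → X} (hS : ∀ z, f z ∈ S) (hf : IsMorphism f) :
    IsMorphism (X := Z) (Y := restrict X S) (fun z => ⟨f z, hS z⟩) :=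
  isMorphism_iff.2 fun z => (isMorphism_iff.1 hf z).codRestrict hS

theorem Isomorphic.symm (h : Isomorphic X Y) : Isomorphic Y X := by
  obtain ⟨e, h1, h2⟩ := h
  exact ⟨e.symm, h2, by simpa using h1⟩

theorem Isomorphic.refl (X : FunSpace) : Isomorphic X X :=
  ⟨Equiv.refl _, isMorphism_id, isMorphism_id⟩

theorem Isomorphic.trans (h : Isomorphic X Y) (h' : Isomorphic Y Z) : Isomorphic X Z := by
  obtain ⟨e, h1, h2⟩ := h
  obtain ⟨e', h1', h2'⟩ := h'
  exact ⟨e.trans e', h1'.comp h1, h2.comp h2'⟩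

/-- A map regular along `S` and a morphism defined on `T` that are inverse to each other give an
isomorphism between `S` and `T`. -/
theorem isomorphic_restrict {S : Set X} {T : Set Y} (f : X → Y) (g : restrict Y T → X)
    (hf : ∀ x ∈ S, RegularMapAt f x) (hfS : ∀ x ∈ S, f x ∈ T) (hg : IsMorphism g)
    (hgT : ∀ y, g y ∈ S) (hgf : ∀ x (hx : x ∈ S), g ⟨f x, hfS x hx⟩ = x)
    (hfg : ∀ y, f (g y) = y.1) : Isomorphic (restrict X S) (restrict Y T) := by
  refine ⟨⟨fun x => ⟨f x.1, hfS _ x.2⟩, fun y => ⟨g y, hgT y⟩, fun x => Subtype.ext (hgf _ x.2),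
    fun y => Subtype.ext (hfg y)⟩, ?_, hg.codRestrict hgT⟩
  refine isMorphism_iff.2 fun x => ?_
  exact RegularMapAt.codRestrict (X := Y) (Z := restrict X S) (f := fun x => f x.1)
    (fun z => hfS _ z.2) (RegularMapAt.comp (hf _ x.2) (isMorphism_iff.1 isMorphism_val x))

/-- An isomorphism of subspaces restricts to smaller subspaces. -/
theorem isomorphic_restrict_of_subset {A A' : Set X} {B : Set Y}
    (e : (restrict X A).carrier ≃ (restrict Y B).carrier)
    (he : IsMorphism (X := restrict X A) (Y := restrict Y B) e)
    (he' : IsMorphism (X := restrict Y B) (Y := restrict X A) e.symm) (hA : A' ⊆ A) :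
    Isomorphic (restrict X A')
      (restrict Y {y | ∃ h : y ∈ B, (e.symm ⟨y, h⟩).1 ∈ A'}) := by
  set B' : Set Y := {y | ∃ h : y ∈ B, (e.symm ⟨y, h⟩).1 ∈ A'}
  have i1 : IsMorphism (X := restrict X A') (Y := restrict X A) (fun x => ⟨x.1, hA x.2⟩) :=
    isMorphism_val.codRestrict _
  have i2 : IsMorphism (X := restrict Y B') (Y := restrict Y B) (fun x => ⟨x.1, x.2.1⟩) :=
    isMorphism_val.codRestrict _
  have j1 : IsMorphism (X := restrict X A') (Y := Y) (fun x => (e ⟨x.1, hA x.2⟩).1) :=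
    isMorphism_val.comp (he.comp i1)
  have j2 : IsMorphism (X := restrict Y B') (Y := X) (fun y => (e.symm ⟨y.1, y.2.1⟩).1) :=
    isMorphism_val.comp (he'.comp i2)
  have h1 : ∀ x : restrict X A', (e ⟨x.1, hA x.2⟩).1 ∈ B' := fun x => by
    refine ⟨(e ⟨x.1, hA x.2⟩).2, ?_⟩
    exact (congrArg (fun z => z.1 ∈ A') (e.symm_apply_apply ⟨x.1, hA x.2⟩)).mpr x.2
  have h2 : ∀ y : restrict Y B', (e.symm ⟨y.1, y.2.1⟩).1 ∈ A' := fun y => y.2.2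
  refine ⟨⟨fun x => ⟨_, h1 x⟩, fun y => ⟨_, h2 y⟩, fun x => ?_, fun y => ?_⟩,
    j1.codRestrict h1, j2.codRestrict h2⟩
  · apply Subtype.ext
    exact (congrArg Subtype.val (e.symm_apply_apply ⟨x.1, hA x.2⟩):)
  · apply Subtype.ext
    exact (congrArg Subtype.val (e.apply_symm_apply ⟨y.1, y.2.1⟩):)

theorem isLocallyClosed_transport {A A' : Set X} {B : Set Y}
    (e : (restrict X A).carrier ≃ (restrict Y B).carrier)
    (he' : IsMorphism (X := restrict Y B) (Y := restrict X A) e.symm)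
    (hA' : IsLocallyClosed A') (hB : IsLocallyClosed B) :
    IsLocallyClosed {y : Y | ∃ h : y ∈ B, (e.symm ⟨y, h⟩).1 ∈ A'} := by
  have h1 : IsLocallyClosed ((fun y : B => (e.symm y).1) ⁻¹' A') :=
    hA'.preimage (isMorphism_val.comp he').1
  have h2 := h1.image Topology.IsInducing.subtypeVal (by simpa using hB)
  convert h2 using 1
  ext y
  constructor
  · rintro ⟨h, h'⟩
    exact ⟨⟨y, h⟩, h', rfl⟩
  · rintro ⟨⟨y, h⟩, h', rfl⟩
    exact ⟨h, h'⟩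

/-! ### Algebra of regular functions on subsets, quotients and affine spaces. -/

/-- The regular functions at a point form a local ring. -/
structure Nice (X : FunSpace) : Prop where
  const : ∀ (c : ℂ) (x : X), X.RegularAt (fun _ => c) x
  add : ∀ (f g : X → ℂ) (x : X), X.RegularAt f x → X.RegularAt g x →
    X.RegularAt (fun z => f z + g z) x
  mul : ∀ (f g : X → ℂ) (x : X), X.RegularAt f x → X.RegularAt g x →
    X.RegularAt (fun z => f z * g z) x
  inv : ∀ (f : X → ℂ) (x : X), X.RegularAt f x → f x ≠ 0 → X.RegularAt (fun z => (f z)⁻¹) x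
  eventually_ne : ∀ (f : X → ℂ) (x : X), X.RegularAt f x → f x ≠ 0 → ∀ᶠ y in 𝓝 x, f y ≠ 0

theorem Nice.restrict (hX : Nice X) (S : Set X) : Nice (restrict X S) where
  const c x := ⟨fun _ => c, hX.const c x.1, Filter.Eventually.of_forall fun _ => rfl⟩
  add := by
    rintro f g x ⟨F, hF, h⟩ ⟨F', hF', h'⟩
    refine ⟨_, hX.add _ _ _ hF hF', ?_⟩
    filter_upwards [h, h'] with y h1 h2
    rw [h1, h2]
  mul := by
    rintro f g x ⟨F, hF, h⟩ ⟨F', hF', h'⟩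
    refine ⟨_, hX.mul _ _ _ hF hF', ?_⟩
    filter_upwards [h, h'] with y h1 h2
    rw [h1, h2]
  inv := by
    rintro f x ⟨F, hF, h⟩ h0
    refine ⟨_, hX.inv _ _ hF (by rwa [← h.self_of_nhds]), ?_⟩
    filter_upwards [h] with y h1
    rw [h1]
  eventually_ne := by
    rintro f x ⟨F, hF, h⟩ h0
    have h1 := hX.eventually_ne _ _ hF (by rwa [← h.self_of_nhds])
    have h2 : ∀ᶠ y : S in 𝓝 x, F y ≠ 0 := continuous_subtype_val.continuousAt.eventually h1
    filter_upwards [h, h2] with y h3 h4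
    rwa [h3]

theorem Nice.coinduced (hX : Nice X) {W : Type} (q : X → W) : Nice (coinduced X q) where
  const c x := Filter.Eventually.of_forall fun _ _ _ => hX.const c _
  add := by
    intro f g x hf hg
    filter_upwards [hf, hg] with z h1 h2 y hy using hX.add _ _ _ (h1 y hy) (h2 y hy)
  mul := by
    intro f g x hf hg
    filter_upwards [hf, hg] with z h1 h2 y hy using hX.mul _ _ _ (h1 y hy) (h2 y hy)
  eventually_ne := by
    let _ : TopologicalSpace W := TopologicalSpace.coinduced q X.top
    intro f x hf h0
    change W at x
    change W → ℂ at f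
    obtain ⟨U, hU, hUo, hxU⟩ := eventually_nhds_iff.1 hf
    -- Openness in the quotient topology is tested upstairs, where the pull-back of `f` is regular
    -- on the preimage of `U`.
    have : IsOpen {z : W | z ∈ U ∧ f z ≠ 0} := by
      refine isOpen_coinduced.2 (isOpen_iff_mem_nhds.2 fun y hy => ?_)
      have h1 : q ⁻¹' U ∈ 𝓝 y := (isOpen_coinduced.1 hUo).mem_nhds hy.1
      filter_upwards [h1, hX.eventually_ne _ _ (hU _ hy.1 y rfl) hy.2] with z h2 h3
      exact ⟨h2, h3⟩
    filter_upwards [this.mem_nhds ⟨hxU, h0⟩] with z hz using hz.2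
  inv := by
    let _ : TopologicalSpace W := TopologicalSpace.coinduced q X.top
    intro f x hf h0
    change W at x
    change W → ℂ at f
    obtain ⟨U, hU, hUo, hxU⟩ := eventually_nhds_iff.1 hf
    have : IsOpen {z : W | z ∈ U ∧ f z ≠ 0} := by
      refine isOpen_coinduced.2 (isOpen_iff_mem_nhds.2 fun y hy => ?_)
      have h1 : q ⁻¹' U ∈ 𝓝 y := (isOpen_coinduced.1 hUo).mem_nhds hy.1
      filter_upwards [h1, hX.eventually_ne _ _ (hU _ hy.1 y rfl) hy.2] with z h2 h3
      exact ⟨h2, h3⟩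
    have h4 : ∀ᶠ z in 𝓝 x, ∀ y, q y = z → X.RegularAt (fun y => (f (q y))⁻¹) y := by
      filter_upwards [this.mem_nhds ⟨hxU, h0⟩] with z hz y hy
      subst hy
      exact hX.inv _ _ (hU _ hz.1 y rfl) hz.2
    exact h4

theorem isMorphism_coinduced_mk {W : Type} (q : X → W) :
    IsMorphism (X := X) (Y := coinduced X q) q := by
  let _ : TopologicalSpace W := TopologicalSpace.coinduced q X.top
  refine ⟨(continuous_coinduced_rng : Continuous q), fun g x hg => ?_⟩
  have h2 : ∀ᶠ z in 𝓝 (q x), ∀ x, q x = z → X.RegularAt (fun y => g (q y)) x := hg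
  exact h2.self_of_nhds x rfl

/-- A map out of a quotient is regular on an open set if its pull-back is. -/
theorem regularMapAt_coinduced {W : Type} {q : X → W} {a : coinduced X q → Y}
    {U : Set (coinduced X q)} (hU : IsOpen U)
    (h : ∀ x, q x ∈ U → RegularMapAt (X := X) (Y := Y) (fun x => a (q x)) x)
    {w : coinduced X q} (hw : w ∈ U) : RegularMapAt a w := by
  let _ : TopologicalSpace W := TopologicalSpace.coinduced q X.top
  change W at w
  change W → Y at a
  change Set W at U
  have hc : ∀ w ∈ U, ContinuousAt a w := by
    intro w hw
    refine continuousAt_def.2 fun V hV => ?_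
    obtain ⟨V', hV', hV'o, hwV'⟩ := mem_nhds_iff.1 hV
    have : IsOpen {z : W | z ∈ U ∧ a z ∈ V'} := by
      refine isOpen_coinduced.2 (isOpen_iff_mem_nhds.2 fun y hy => ?_)
      have h1 : q ⁻¹' U ∈ 𝓝 y := (isOpen_coinduced.1 hU).mem_nhds hy.1
      filter_upwards [h1, (h y hy.1).1 (hV'o.mem_nhds hy.2)] with z h2 h3
      exact ⟨h2, h3⟩
    filter_upwards [this.mem_nhds ⟨hw, hwV'⟩] with z hz using hV' hz.2
  refine ⟨hc w hw, fun g hg => ?_⟩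
  have h1 : ∀ᶠ z in 𝓝 w, Y.RegularAt g (a z) :=
    (hc w hw).eventually (Y.eventually_regularAt g _ hg)
  have h2 : ∀ᶠ z in 𝓝 w, ∀ x, q x = z → X.RegularAt (fun y => g (a (q y))) x := by
    filter_upwards [h1, IsOpen.mem_nhds hU hw] with z h1 h2 x hx
    subst hx
    exact (h x h2).2 g h1
  exact h2

theorem isOpen_eval_ne {σ : Type} (p : MvPolynomial σ ℂ) :
    IsOpen {x : affine σ | MvPolynomial.eval x p ≠ 0} :=
  TopologicalSpace.isOpen_generateFrom_of_mem ⟨p, rfl⟩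

theorem eventually_eval_ne {σ : Type} {p : MvPolynomial σ ℂ} {x : σ → ℂ}
    (h : MvPolynomial.eval x p ≠ 0) :
    ∀ᶠ y in @nhds (σ → ℂ) (zariski σ) x, MvPolynomial.eval y p ≠ 0 :=
  (isOpen_eval_ne p).mem_nhds h

theorem nice_affine (σ : Type) : Nice (affine σ) where
  const c x := ⟨MvPolynomial.C c, 1, by simp, Filter.Eventually.of_forall fun _ => by simp⟩
  add := by
    rintro f g x ⟨p, q, hq, h⟩ ⟨p', q', hq', h'⟩
    refine ⟨p * q' + q * p', q * q', by simp [hq, hq'], ?_⟩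
    filter_upwards [h, h', eventually_eval_ne hq, eventually_eval_ne hq']
      with y h1 h2 h3 h4
    rw [h1, h2, div_add_div _ _ h3 h4]
    simp
  mul := by
    rintro f g x ⟨p, q, hq, h⟩ ⟨p', q', hq', h'⟩
    refine ⟨p * p', q * q', by simp [hq, hq'], ?_⟩
    filter_upwards [h, h'] with y h1 h2
    rw [h1, h2, div_mul_div_comm]
    simp
  inv := by
    rintro f x ⟨p, q, hq, h⟩ h0
    let _ : TopologicalSpace (σ → ℂ) := zariski σ
    have h1 : f x = _ := h.self_of_nhds
    refine ⟨q, p, fun h2 => h0 (by rw [h1, h2, zero_div]), ?_⟩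
    filter_upwards [h] with y h1
    rw [h1, inv_div]
  eventually_ne := by
    rintro f x ⟨p, q, hq, h⟩ h0
    let _ : TopologicalSpace (σ → ℂ) := zariski σ
    have h1 : f x = _ := h.self_of_nhds
    have hp : MvPolynomial.eval x p ≠ 0 := fun h2 => h0 (by rw [h1, h2, zero_div])
    filter_upwards [h, eventually_eval_ne hq, eventually_eval_ne hp]
      with y h1 h2 h3
    rw [h1]
    exact div_ne_zero h3 h2

theorem regularAt_coord {σ : Type} (i : σ) (x : affine σ) :
    (affine σ).RegularAt (fun z : σ → ℂ => z i) x :=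
  ⟨MvPolynomial.X i, 1, by simp, Filter.Eventually.of_forall fun _ => by simp⟩

theorem Nice.eval (hX : Nice X) {σ : Type} {f : X → σ → ℂ} {x : X}
    (hf : ∀ i, X.RegularAt (fun z => f z i) x) (p : MvPolynomial σ ℂ) :
    X.RegularAt (fun z => MvPolynomial.eval (f z) p) x := by
  induction p using MvPolynomial.induction_on with
  | C c => simpa using hX.const c x
  | add p q hp hq => simpa using hX.add _ _ _ hp hq
  | mul_X p i hp => simpa using hX.mul _ _ _ hp (hf i)

theorem Nice.pow (hX : Nice X) {f : X → ℂ} {x : X} (hf : X.RegularAt f x) (n : ℕ) :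
    X.RegularAt (fun z => f z ^ n) x := by
  induction n with
  | zero => simpa using hX.const 1 x
  | succ n ih => simpa [pow_succ] using hX.mul _ _ _ ih hf

theorem Nice.zpow (hX : Nice X) {f : X → ℂ} {x : X} (hf : X.RegularAt f x) (h0 : f x ≠ 0)
    (n : ℤ) : X.RegularAt (fun z => f z ^ n) x := by
  obtain ⟨n, rfl | rfl⟩ := n.eq_nat_or_neg
  · simpa using hX.pow hf n
  · simpa using hX.inv _ _ (hX.pow hf n) (pow_ne_zero _ h0)

theorem Nice.prod (hX : Nice X) {ι : Type*} (s : Finset ι) {f : ι → X → ℂ} {x : X}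
    (hf : ∀ i ∈ s, X.RegularAt (f i) x) : X.RegularAt (fun z => ∏ i ∈ s, f i z) x := by
  classical
  induction s using Finset.induction_on with
  | empty => simpa using hX.const 1 x
  | insert a s ha ih =>
    simp only [Finset.prod_insert ha]
    exact hX.mul _ _ _ (hf a (by simp)) (ih fun i hi => hf i (by simp [hi]))

/-- A map to affine space is regular at a point if its coordinates are. -/
theorem Nice.regularMapAt_affine (hX : Nice X) {σ : Type} {f : X → affine σ} {x : X}
    (hf : ∀ i, X.RegularAt (fun z => (f z : σ → ℂ) i) x) : RegularMapAt f x := by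
  have hc : ContinuousAt f x := by
    refine TopologicalSpace.tendsto_nhds_generateFrom_iff.2 ?_
    rintro _ ⟨p, rfl⟩ hp
    exact hX.eventually_ne _ _ (hX.eval hf p) hp
  refine ⟨hc, ?_⟩
  rintro g ⟨p, q, hq, h⟩
  refine X.regularAt_congr _ _ x ?_
    (hX.mul _ _ _ (hX.eval hf p) (hX.inv _ _ (hX.eval hf q) hq))
  filter_upwards [hc.eventually h] with y hy
  rw [hy, div_eq_mul_inv]

theorem nice_projSpace (n : ℕ) : Nice (projSpace n) :=
  ((nice_affine _).restrict _).coinduced _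

end FunSpace

open FunSpace

/-! ### Relations in the Grothendieck ring and additivity over locally closed partitions. -/

theorem QPVar.nice (Q : QPVar) : Nice Q.toSpace := (nice_projSpace _).restrict _

theorem K0Relation.mk_eq_zero {r : MvPolynomial QPVar ℤ} (h : K0Relation r) :
    (Ideal.Quotient.mk (Ideal.span {r | K0Relation r})) r = 0 :=
  Ideal.Quotient.eq_zero_iff_mem.2 (Ideal.subset_span h)

theorem varClass_eq_of_isomorphic {X Y : QPVar} (h : Isomorphic X.toSpace Y.toSpace) :
    varClass X = varClass Y := by
  have := (K0Relation.iso X Y h).mk_eq_zero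
  rwa [map_sub, sub_eq_zero] at this

theorem varClass_eq_mul {X Y P : QPVar} (h : IsProduct X Y P) :
    varClass P = varClass X * varClass Y := by
  have := (K0Relation.prod X Y P h).mk_eq_zero
  rwa [map_sub, map_mul, sub_eq_zero] at this

theorem varClass_eq_one {X : QPVar} (h : ∃! x, x ∈ X.set) : varClass X = 1 := by
  have := (K0Relation.point X h).mk_eq_zero
  rwa [map_sub, map_one, sub_eq_zero] at this

open scoped Classical in
/-- The class of a locally closed subset of a projective space. -/
def projClass (n : ℕ) (S : Set (projSpace n)) : K0 :=
  if h : IsLocallyClosed S then varClass ⟨n, S, h⟩ else 0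

theorem projClass_eq {n : ℕ} {S : Set (projSpace n)} (h : IsLocallyClosed S) :
    projClass n S = varClass ⟨n, S, h⟩ := dif_pos h

theorem QPVar.projClass_set (Q : QPVar) : projClass Q.dim Q.set = varClass Q :=
  projClass_eq Q.isLocallyClosed

theorem projClass_inter_add_compl {n : ℕ} {S A : Set (projSpace n)} (hS : IsLocallyClosed S)
    (hA : IsClosed A) : projClass n S = projClass n (S ∩ A) + projClass n (S ∩ Aᶜ) := by
  have := (K0Relation.scissor ⟨n, S, hS⟩ A hA).mk_eq_zero
  rw [map_sub, map_add, sub_eq_zero] at this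
  rw [projClass_eq hS, projClass_eq (hS.inter hA.isLocallyClosed),
    projClass_eq (hS.inter hA.isOpen_compl.isLocallyClosed)]
  exact this

theorem projClass_empty (n : ℕ) : projClass n ∅ = 0 := by
  have := projClass_inter_add_compl (n := n) (S := ∅) isClosed_empty.isLocallyClosed isClosed_empty
  rw [Set.empty_inter, Set.empty_inter] at this
  simpa using this

/-- The scissor relation cuts along closed sets only. Writing one part as `Z a = U ∩ F`, with `U`
open and `F` closed, cut `S` first along `F` and then along `Uᶜ`. The two pieces outside `Z a` are
covered by the remaining parts, so induction applies to them; by disjointness they exhaust every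
other `S ∩ Z i`. -/
theorem projClass_eq_sum {n : ℕ} {ι : Type*} (s : Finset ι) (Z : ι → Set (projSpace n))
    (hZ : ∀ i, IsLocallyClosed (Z i)) (hd : ∀ i j, i ≠ j → Disjoint (Z i) (Z j))
    (S : Set (projSpace n)) (hS : IsLocallyClosed S) (hsub : S ⊆ ⋃ i ∈ s, Z i) :
    projClass n S = ∑ i ∈ s, projClass n (S ∩ Z i) := by
  classical
  induction s using Finset.induction_on generalizing S with
  | empty =>
    have : S = ∅ := by simpa using hsub
    simp [this, projClass_empty]
  | insert a s ha ih =>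
    obtain ⟨U, F, hU, hF, hUF⟩ := hZ a
    have hUc : IsClosed Uᶜ := hU.isClosed_compl
    have hFo := hF.isOpen_compl.isLocallyClosed
    have h1 : projClass n (S ∩ Fᶜ) = ∑ i ∈ s, projClass n (S ∩ Fᶜ ∩ Z i) := by
      refine ih _ (hS.inter hFo) fun x hx => ?_
      have := hsub hx.1
      simp only [Finset.mem_insert, Set.iUnion_iUnion_eq_or_left] at this
      exact this.resolve_left fun h => hx.2 (by rw [hUF] at h; exact h.2)
    have h2 : projClass n (S ∩ F ∩ Uᶜ) = ∑ i ∈ s, projClass n (S ∩ F ∩ Uᶜ ∩ Z i) := by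
      refine ih _ ((hS.inter hF.isLocallyClosed).inter hUc.isLocallyClosed) fun x hx => ?_
      have := hsub hx.1.1
      simp only [Finset.mem_insert, Set.iUnion_iUnion_eq_or_left] at this
      exact this.resolve_left fun h => hx.2 (by rw [hUF] at h; exact h.1)
    have h3 : ∀ i ∈ s, projClass n (S ∩ Z i) =
        projClass n (S ∩ F ∩ Uᶜ ∩ Z i) + projClass n (S ∩ Fᶜ ∩ Z i) := by
      intro i hi
      have hai : a ≠ i := fun h => ha (h ▸ hi)
      have hSi := hS.inter (hZ i)
      rw [projClass_inter_add_compl hSi hF,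
        projClass_inter_add_compl (hSi.inter hF.isLocallyClosed) hUc]
      have e1 : S ∩ Z i ∩ F ∩ Uᶜᶜ = ∅ := by
        rw [Set.eq_empty_iff_forall_notMem]
        rintro x ⟨⟨⟨-, hx1⟩, hx2⟩, hx3⟩
        refine Set.disjoint_left.1 (hd a i hai) ?_ hx1
        rw [hUF]
        exact ⟨by simpa using hx3, hx2⟩
      have e2 : S ∩ Z i ∩ F ∩ Uᶜ = S ∩ F ∩ Uᶜ ∩ Z i := by
        ext; simp only [Set.mem_inter_iff]; tauto
      have e3 : S ∩ Z i ∩ Fᶜ = S ∩ Fᶜ ∩ Z i := by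
        ext; simp only [Set.mem_inter_iff]; tauto
      rw [e1, e2, e3, projClass_empty, add_zero]
    rw [Finset.sum_insert ha, Finset.sum_congr rfl h3, Finset.sum_add_distrib, ← h1, ← h2,
      projClass_inter_add_compl hS hF,
      projClass_inter_add_compl (hS.inter hF.isLocallyClosed) hUc]
    have e4 : S ∩ F ∩ Uᶜᶜ = S ∩ Z a := by
      rw [hUF, compl_compl, Set.inter_assoc, Set.inter_comm F U]
    rw [e4]
    ring

/-! ### Pieces with a class, and independence of the class from the partition. -/

/-- `A` is a locally closed subset that is a quasi-projective variety with class `c`. -/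
def IsPiece (X : FunSpace) (A : Set X) (c : K0) : Prop :=
  IsLocallyClosed A ∧ ∃ Q : QPVar, Isomorphic (restrict X A) Q.toSpace ∧ c = varClass Q

theorem IsPiece.of_isomorphic {X Y : FunSpace} {A : Set X} {B : Set Y} {c : K0}
    (hA : IsPiece X A c) (hB : IsLocallyClosed B) (h : Isomorphic (restrict X A) (restrict Y B)) :
    IsPiece Y B c := by
  obtain ⟨-, Q, hQ, rfl⟩ := hA
  exact ⟨hB, Q, h.symm.trans hQ, rfl⟩

theorem IsPiece.unique {X Y : FunSpace} {A : Set X} {B : Set Y} {c c' : K0}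
    (hA : IsPiece X A c) (hB : IsPiece Y B c') (h : Isomorphic (restrict X A) (restrict Y B)) :
    c = c' := by
  obtain ⟨-, Q, hQ, rfl⟩ := hA
  obtain ⟨-, Q', hQ', rfl⟩ := hB
  exact varClass_eq_of_isomorphic (hQ.symm.trans (h.trans hQ'))

/-- The partition is carried over to the projective model of `A`, where additivity is known. -/
theorem IsPiece.exists_sum {X : FunSpace} {A : Set X} {c : K0} (hA : IsPiece X A c)
    {ι : Type*} [Fintype ι] (T : ι → Set X) (hT : ∀ i, IsLocallyClosed (T i))
    (hd : ∀ i j, i ≠ j → Disjoint (T i) (T j)) (hsub : A ⊆ ⋃ i, T i) :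
    ∃ c' : ι → K0, (∀ i, IsPiece X (A ∩ T i) (c' i)) ∧ c = ∑ i, c' i := by
  obtain ⟨hAl, Q, ⟨e, he, he'⟩, rfl⟩ := hA
  set Z : ι → Set (projSpace Q.dim) := fun i =>
    {y | ∃ h : y ∈ Q.set, (e.symm ⟨y, h⟩).1 ∈ A ∩ T i}
  have hZ : ∀ i, IsLocallyClosed (Z i) := fun i =>
    isLocallyClosed_transport (A' := A ∩ T i) e he' (hAl.inter (hT i)) Q.isLocallyClosed
  refine ⟨fun i => projClass Q.dim (Z i), fun i => ⟨hAl.inter (hT i), ⟨Q.dim, Z i, hZ i⟩,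
    isomorphic_restrict_of_subset e he he' Set.inter_subset_left, projClass_eq (hZ i)⟩, ?_⟩
  rw [← Q.projClass_set, projClass_eq_sum Finset.univ Z hZ ?_ Q.set Q.isLocallyClosed ?_]
  · refine Finset.sum_congr rfl fun i _ => ?_
    rw [Set.inter_eq_right.2]
    rintro y ⟨h, -⟩
    exact h
  · intro i j hij
    refine Set.disjoint_left.2 ?_
    rintro y ⟨h, h1⟩ ⟨_, h2⟩
    exact Set.disjoint_left.1 (hd i j hij) h1.2 h2.2
  · intro y hy
    obtain ⟨i, hi⟩ := Set.mem_iUnion.1 (hsub (e.symm ⟨y, hy⟩).2)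
    simp only [Finset.mem_univ, Set.iUnion_true, Set.mem_iUnion]
    exact ⟨i, hy, (e.symm ⟨y, hy⟩).2, hi⟩

theorem HasClass.of_pieces {X : FunSpace} {S : Set X} {ι : Type*} [Fintype ι]
    (A : ι → Set X) (c : ι → K0) (hA : ∀ i, IsPiece X (A i) (c i))
    (hd : ∀ i j, i ≠ j → Disjoint (A i) (A j)) (hS : S = ⋃ i, A i) :
    HasClass X S (∑ i, c i) := by
  choose hAl Q hQ hc using hA
  let e := (Fintype.equivFin ι).symm
  refine ⟨Fintype.card ι, fun i => A (e i), fun i => Q (e i), fun i => hAl _,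
    fun i j hij => hd _ _ (e.injective.ne hij), ?_, fun i => hQ _, ?_⟩
  · rw [hS, e.surjective.iUnion_comp A]
  · rw [← e.sum_comp]
    exact Finset.sum_congr rfl fun i _ => hc _

theorem HasClass.exists_pieces {X : FunSpace} {S : Set X} {c : K0} (h : HasClass X S c) :
    ∃ (k : ℕ) (A : Fin k → Set X) (c' : Fin k → K0), (∀ i, IsPiece X (A i) (c' i)) ∧
      (∀ i j, i ≠ j → Disjoint (A i) (A j)) ∧ S = ⋃ i, A i ∧ c = ∑ i, c' i := by
  obtain ⟨k, A, Q, hA, hd, hS, hQ, hc⟩ := h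
  exact ⟨k, A, fun i => varClass (Q i), fun i => ⟨hA i, Q i, hQ i, rfl⟩, hd, hS, hc⟩

/-- Two partitions have a common refinement, and both sums equal the sum over its pieces. -/
theorem HasClass.unique {X : FunSpace} {S : Set X} {c c' : K0} (h : HasClass X S c)
    (h' : HasClass X S c') : c = c' := by
  obtain ⟨k, A, a, hA, hd, hS, rfl⟩ := h.exists_pieces
  obtain ⟨l, B, b, hB, hd', hS', rfl⟩ := h'.exists_pieces
  have h1 : ∀ i, ∃ f : Fin l → K0, (∀ j, IsPiece X (A i ∩ B j) (f j)) ∧ a i = ∑ j, f j :=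
    fun i => (hA i).exists_sum B (fun j => (hB j).1) hd'
      (by rw [← hS', hS]; exact Set.subset_iUnion A i)
  have h2 : ∀ j, ∃ f : Fin k → K0, (∀ i, IsPiece X (B j ∩ A i) (f i)) ∧ b j = ∑ i, f i :=
    fun j => (hB j).exists_sum A (fun i => (hA i).1) hd
      (by rw [← hS, hS']; exact Set.subset_iUnion B j)
  choose f hf hf' using h1
  choose g hg hg' using h2
  simp_rw [hf', hg']
  rw [Finset.sum_comm]
  refine Finset.sum_congr rfl fun j _ => Finset.sum_congr rfl fun i _ => ?_
  refine (hf i j).unique (hg j i) ?_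
  rw [Set.inter_comm]
  exact Isomorphic.refl _

theorem HasClass.cls_eq {X : FunSpace} {S : Set X} {c : K0} (h : HasClass X S c) :
    cls X S = c := by
  have h' : ∃ c, HasClass X S c := ⟨c, h⟩
  rw [cls, dif_pos h']
  exact h'.choose_spec.unique h

theorem IsPiece.hasClass {X : FunSpace} {A : Set X} {c : K0} (h : IsPiece X A c) :
    HasClass X A c := by
  simpa using HasClass.of_pieces (ι := Unit) (fun _ => A) (fun _ => c) (fun _ => h)
    (fun i j hij => (hij rfl).elim) (Set.iUnion_const A).symm

/-! ### Constructible sets and locally closed sets. -/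

/-- A constructible set is a finite disjoint union of locally closed sets. -/
theorem exists_iUnion_of_isConstructible {X : Type*} [TopologicalSpace X] {S : Set X}
    (hS : Topology.IsConstructible S) :
    ∃ (k : ℕ) (A : Fin k → Set X), (∀ i, IsLocallyClosed (A i)) ∧
      (∀ i j, i ≠ j → Disjoint (A i) (A j)) ∧ S = ⋃ i, A i := by
  classical
  let P : Set X → Prop := fun S => ∃ (k : ℕ) (A : Fin k → Set X), (∀ i, IsLocallyClosed (A i)) ∧
      (∀ i j, i ≠ j → Disjoint (A i) (A j)) ∧ S = ⋃ i, A i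
  have mk : ∀ {ι : Type} [Fintype ι] (A : ι → Set X), (∀ i, IsLocallyClosed (A i)) →
      (∀ i j, i ≠ j → Disjoint (A i) (A j)) → P (⋃ i, A i) := by
    intro ι _ A h1 h2
    let e := (Fintype.equivFin ι).symm
    exact ⟨Fintype.card ι, fun i => A (e i), fun i => h1 _,
      fun i j hij => h2 _ _ (e.injective.ne hij), (e.surjective.iUnion_comp A).symm⟩
  have single : ∀ A : Set X, IsLocallyClosed A → P A := fun A hA => by
    rw [← Set.iUnion_const (ι := Unit) A]
    exact mk (fun _ => A) (fun _ => hA) fun i j hij => (hij rfl).elim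
  have inter : ∀ S T, P S → P T → P (S ∩ T) := by
    rintro _ _ ⟨k, A, hA, hd, rfl⟩ ⟨l, B, hB, hd', rfl⟩
    have := mk (ι := Fin k × Fin l) (fun i => A i.1 ∩ B i.2) (fun i => (hA _).inter (hB _)) ?_
    · convert this using 1
      ext x
      simp only [Set.mem_inter_iff, Set.mem_iUnion, Prod.exists]
      constructor
      · rintro ⟨⟨i, hi⟩, j, hj⟩
        exact ⟨i, j, hi, hj⟩
      · rintro ⟨i, j, hi, hj⟩
        exact ⟨⟨i, hi⟩, j, hj⟩
    · rintro ⟨i, j⟩ ⟨i', j'⟩ hne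
      refine Set.disjoint_left.2 ?_
      rintro x ⟨h1, h2⟩ ⟨h3, h4⟩
      have e1 : i = i' := by
        by_contra h
        exact Set.disjoint_left.1 (hd _ _ h) h1 h3
      have e2 : j = j' := by
        by_contra h
        exact Set.disjoint_left.1 (hd' _ _ h) h2 h4
      exact hne (by rw [e1, e2])
  have disj : ∀ S T, P S → P T → Disjoint S T → P (S ∪ T) := by
    rintro _ _ ⟨k, A, hA, hd, rfl⟩ ⟨l, B, hB, hd', rfl⟩ hdis
    rw [Set.disjoint_iUnion_left] at hdis
    simp_rw [Set.disjoint_iUnion_right] at hdis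
    have := mk (ι := Fin k ⊕ Fin l) (Sum.elim A B) ?_ ?_
    · rwa [Set.iUnion_sumElim] at this
    · rintro (i | i)
      exacts [hA i, hB i]
    · rintro (i | i) (j | j) hij
      · exact hd _ _ fun h => hij (by rw [h])
      · exact hdis i j
      · exact (hdis j i).symm
      · exact hd' _ _ fun h => hij (by rw [h])
  have complLC : ∀ A, IsLocallyClosed A → P Aᶜ := by
    rintro _ ⟨U, F, hU, hF, rfl⟩
    have : (U ∩ F)ᶜ = Fᶜ ∪ (F ∩ Uᶜ) := by
      ext; simp only [Set.mem_compl_iff, Set.mem_inter_iff, Set.mem_union]; tauto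
    rw [this]
    refine disj _ _ (single _ hF.isOpen_compl.isLocallyClosed)
      (single _ (hF.isLocallyClosed.inter hU.isClosed_compl.isLocallyClosed)) ?_
    exact Set.disjoint_left.2 fun x h1 h2 => h1 h2.1
  have compl : ∀ S, P S → P Sᶜ := by
    rintro _ ⟨k, A, hA, -, rfl⟩
    induction k with
    | zero => simpa using single Set.univ isOpen_univ.isLocallyClosed
    | succ k ih =>
      have : (⋃ i, A i)ᶜ = (A 0)ᶜ ∩ (⋃ i, A (Fin.succ i))ᶜ := by
        ext x
        simp [Fin.forall_fin_succ]
      rw [this]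
      exact inter _ _ (complLC _ (hA 0)) (ih _ fun i => hA _)
  -- Constructible sets form the Boolean algebra generated by the retrocompact open sets; unions
  -- reduce to intersections and complements by De Morgan, so disjointness need not be arranged by
  -- hand.
  induction hS using BooleanSubalgebra.closure_bot_sup_induction with
  | mem x hx => exact single _ hx.1.isLocallyClosed
  | bot => exact single _ isClosed_empty.isLocallyClosed
  | sup x _ y _ hx hy =>
    have := compl _ (inter _ _ (compl _ hx) (compl _ hy))
    rwa [Set.compl_inter, compl_compl, compl_compl] at this
  | compl x _ hx => exact compl _ hx

theorem IsLocallyClosed.isConstructible {X : Type*} [TopologicalSpace X]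
    [TopologicalSpace.NoetherianSpace X] {S : Set X} (hS : IsLocallyClosed S) :
    Topology.IsConstructible S := by
  have key : ∀ U : Set X, IsOpen U → Topology.IsConstructible U := fun U hU =>
    _root_.IsRetrocompact.isConstructible hU
      fun V _ _ => TopologicalSpace.NoetherianSpace.isCompact _
  obtain ⟨U, F, hU, hF, rfl⟩ := hS
  refine (key U hU).inter ?_
  rw [← Topology.isConstructible_compl]
  exact key _ hF.isOpen_compl

/-! ## Locally closed subsets of affine spaces -/

/-- Sending a point to the kernel of evaluation induces the Zariski topology from the prime spectrum
of a polynomial ring in finitely many variables, which is Noetherian. -/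
theorem noetherianSpace_affine (σ : Type) [Finite σ] :
    TopologicalSpace.NoetherianSpace (affine σ) := by
  let F : affine σ → PrimeSpectrum (MvPolynomial σ ℂ) := fun x =>
    ⟨RingHom.ker (MvPolynomial.eval x), RingHom.ker_isPrime _⟩
  have hF : Topology.IsInducing F := by
    refine ⟨?_⟩
    rw [PrimeSpectrum.isTopologicalBasis_basic_opens.eq_generateFrom, induced_generateFrom_eq]
    change TopologicalSpace.generateFrom _ = _
    congr 1
    ext U
    constructor
    · rintro ⟨p, rfl⟩
      exact ⟨_, ⟨p, rfl⟩, rfl⟩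
    · rintro ⟨_, ⟨p, rfl⟩, rfl⟩
      exact ⟨p, rfl⟩
  exact hF.noetherianSpace

theorem isOpen_coord_ne {σ : Type} (i : σ) : IsOpen {x : affine σ | x i ≠ 0} := by
  have h : {x : affine σ | x i ≠ 0} = {x | MvPolynomial.eval x (MvPolynomial.X i) ≠ 0} :=
    Set.ext fun x => not_congr (Eq.congr_left (MvPolynomial.eval_X i).symm)
  rw [h]
  exact isOpen_eval_ne _

theorem isLocallyClosed_inter_preimage {X Y : Type*} [TopologicalSpace X] [TopologicalSpace Y]
    {U : Set X} {a : X → Y} {A : Set Y} (hU : IsLocallyClosed U) (ha : ContinuousOn a U)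
    (hA : IsLocallyClosed A) : IsLocallyClosed {x | x ∈ U ∧ a x ∈ A} := by
  have h1 : IsLocallyClosed (U.domRestrict a ⁻¹' A) :=
    hA.preimage (continuousOn_iff_continuous_domRestrict.1 ha)
  have h2 := h1.image Topology.IsInducing.subtypeVal (by simpa using hU)
  convert h2 using 1
  ext x
  constructor
  · rintro ⟨h, h'⟩
    exact ⟨⟨x, h⟩, h', rfl⟩
  · rintro ⟨⟨x, h⟩, h', rfl⟩
    exact ⟨h, h'⟩

/-- The affine coordinates on a projective space. -/
def projCoord (n : ℕ) : projSpace n → affine (Fin n) :=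
  Projectivization.lift (fun v i => v.1 (Fin.succ i) / v.1 0) (by
    rintro ⟨a, ha⟩ ⟨b, hb⟩ t rfl
    funext i
    have ht : t ≠ 0 := by
      rintro rfl
      simp at ha
    simp only [Pi.smul_apply, smul_eq_mul]
    rw [mul_div_mul_left _ _ ht])

/-- The affine chart of a projective space. -/
def projChart (n : ℕ) : Set (projSpace n) :=
  {w | ∀ v : {v : Fin (n + 1) → ℂ // v ≠ 0}, Projectivization.mk' ℂ v = w → v.1 0 ≠ 0}

theorem mk_mem_projChart {n : ℕ} (v : {v : Fin (n + 1) → ℂ // v ≠ 0}) :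
    (Projectivization.mk' ℂ v : projSpace n) ∈ projChart n ↔ v.1 0 ≠ 0 := by
  refine ⟨fun h => h v rfl, fun h v' hv' => ?_⟩
  obtain ⟨a, ha⟩ := (Projectivization.mk_eq_mk_iff ℂ _ _ v'.2 v.2).1 hv'
  rw [← ha]
  exact mul_ne_zero a.ne_zero h

theorem isOpen_projChart (n : ℕ) : IsOpen (projChart n) := by
  refine isOpen_coinduced.2 ?_
  have h : IsOpen {v : restrict (affine (Fin (n + 1))) {v : Fin (n + 1) → ℂ | v ≠ 0} |
      MvPolynomial.eval v.1 (MvPolynomial.X 0) ≠ 0} :=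
    (isOpen_eval_ne _).preimage continuous_subtype_val
  have h' : (fun v : {v : Fin (n + 1) → ℂ // v ≠ 0} => Projectivization.mk' ℂ v) ⁻¹' projChart n =
      {v | MvPolynomial.eval v.1 (MvPolynomial.X 0) ≠ 0} :=
    Set.ext fun v => (mk_mem_projChart v).trans (by rw [Set.mem_ofPred_eq, MvPolynomial.eval_X])
  exact (congrArg (fun s => IsOpen[(restrict (affine (Fin (n + 1)))
    {v : Fin (n + 1) → ℂ | v ≠ 0}).top] s) h').mpr h

theorem regularMapAt_projCoord {n : ℕ} {w : projSpace n} (hw : w ∈ projChart n) :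
    RegularMapAt (projCoord n) w := by
  refine regularMapAt_coinduced (isOpen_projChart n) (fun v hv => ?_) hw
  have hX := (nice_affine (Fin (n + 1))).restrict {v : Fin (n + 1) → ℂ | v ≠ 0}
  refine hX.regularMapAt_affine fun i => ?_
  have hc : ∀ j, (restrict (affine (Fin (n + 1))) {v : Fin (n + 1) → ℂ | v ≠ 0}).RegularAt
      (fun z => z.1 j) v := fun j =>
    ⟨_, regularAt_coord j v.1, Filter.Eventually.of_forall fun _ => rfl⟩
  exact hX.mul _ _ _ (hc _) (hX.inv _ _ (hc 0) ((mk_mem_projChart v).1 hv))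

/-- Affine space is the chart of projective space where the coordinate 0 does not vanish, through y
↦ [1 : y]; the image of `A` is locally closed because the chart is open. -/
theorem exists_isPiece_fin {n : ℕ} {A : Set (affine (Fin n))} (hA : IsLocallyClosed A) :
    ∃ c, IsPiece (affine (Fin n)) A c := by
  set T : Set (projSpace n) := {w | w ∈ projChart n ∧ projCoord n w ∈ A}
  have hT : IsLocallyClosed T := isLocallyClosed_inter_preimage (isOpen_projChart n).isLocallyClosed
    (fun w hw => (regularMapAt_projCoord hw).1.continuousWithinAt) hA
  have hne : ∀ y : affine (Fin n), (Fin.cons 1 y : Fin (n + 1) → ℂ) ≠ 0 := fun y h =>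
    one_ne_zero (congrFun h 0)
  refine ⟨_, hA, ⟨n, T, hT⟩, Isomorphic.symm ?_, rfl⟩
  have hg : IsMorphism (X := affine (Fin n)) (Y := projSpace n)
      (fun y => Projectivization.mk' ℂ ⟨Fin.cons 1 y, hne y⟩) := by
    refine (isMorphism_coinduced_mk _).comp
      (IsMorphism.codRestrict (Z := affine (Fin n)) (X := affine (Fin (n + 1)))
        (S := {v : Fin (n + 1) → ℂ | v ≠ 0}) (f := fun y : Fin n → ℂ => (Fin.cons 1 y : Fin (n + 1) → ℂ)) hne ?_)
    refine isMorphism_iff.2 fun y => (nice_affine _).regularMapAt_affine fun i => ?_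
    refine Fin.cases ?_ (fun i => ?_) i
    · exact (nice_affine _).const 1 y
    · exact regularAt_coord i y
  have hfg : ∀ y : affine (Fin n),
      projCoord n (Projectivization.mk' ℂ ⟨Fin.cons 1 y, hne y⟩) = y := fun y => by
    funext i
    exact div_one (y i)
  refine isomorphic_restrict (projCoord n) _ (fun w hw => regularMapAt_projCoord hw.1)
    (fun w hw => hw.2) (hg.comp isMorphism_val) (fun y => ⟨?_, ?_⟩) (fun w hw => ?_)
    (fun y => hfg y.1)
  · exact (mk_mem_projChart _).2 one_ne_zero
  · have := y.2
    rwa [← hfg y.1] at this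
  · induction w using Projectivization.ind with
    | h v hv =>
    have h0 : v 0 ≠ 0 := (mk_mem_projChart ⟨v, hv⟩).1 hw.1
    refine (Projectivization.mk_eq_mk_iff ℂ _ _ (hne _) hv).2 ⟨(Units.mk0 _ h0)⁻¹, ?_⟩
    funext i
    refine Fin.cases ?_ (fun i => ?_) i
    · change (v 0)⁻¹ * v 0 = 1
      exact inv_mul_cancel₀ h0
    · change (v 0)⁻¹ * v i.succ = v i.succ / v 0
      rw [mul_comm, div_eq_mul_inv]

theorem isMorphism_reindex {σ τ : Type} (e : τ → σ) :
    IsMorphism (X := affine σ) (Y := affine τ) (fun x j => x (e j)) :=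
  isMorphism_iff.2 fun x => (nice_affine _).regularMapAt_affine fun j => regularAt_coord (e j) x

theorem isomorphic_reindex {σ τ : Type} (e : τ ≃ σ) (A : Set (affine τ)) :
    Isomorphic (restrict (affine τ) A)
      (restrict (affine σ) {x : σ → ℂ | (fun j => x (e j)) ∈ A}) := by
  refine isomorphic_restrict (X := affine τ) (Y := affine σ) (fun x j => x (e.symm j))
    (fun x j => x.1 (e j)) (fun x _ => isMorphism_iff.1 (isMorphism_reindex _) x) ?_
    ((isMorphism_reindex e).comp isMorphism_val) (fun y => y.2) ?_ ?_
  · intro x hx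
    have : (fun j => x (e.symm (e j))) = x := funext fun j => by rw [e.symm_apply_apply]
    exact (congrArg (· ∈ A) this).mpr hx
  · intro x hx
    funext j
    exact congrArg x (e.symm_apply_apply j)
  · intro y
    funext j
    exact congrArg y.1 (e.apply_symm_apply j)

theorem isLocallyClosed_reindex {σ τ : Type} (e : τ → σ) {A : Set (affine τ)}
    (hA : IsLocallyClosed A) : IsLocallyClosed {x : affine σ | (fun j => x (e j)) ∈ A} :=
  hA.preimage (isMorphism_reindex e).1

theorem IsPiece.reindex {σ τ : Type} (e : τ ≃ σ) {A : Set (affine τ)} {c : K0}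
    (h : IsPiece (affine τ) A c) :
    IsPiece (affine σ) {x : affine σ | (fun j => x (e j)) ∈ A} c :=
  h.of_isomorphic (isLocallyClosed_reindex e h.1) (isomorphic_reindex e A)

theorem exists_isPiece {σ : Type} [Finite σ] {A : Set (affine σ)} (hA : IsLocallyClosed A) :
    ∃ c, IsPiece (affine σ) A c := by
  obtain ⟨n, ⟨e⟩⟩ := Finite.exists_equiv_fin σ
  obtain ⟨c, hc⟩ := exists_isPiece_fin (n := n) (isLocallyClosed_reindex (σ := Fin n) e hA)
  refine ⟨c, hc.of_isomorphic hA (isomorphic_reindex e A).symm⟩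

/-! ## Products -/

/-- The product of subsets of affine spaces. -/
def affineProd {σ τ : Type} (A : Set (affine σ)) (B : Set (affine τ)) : Set (affine (σ ⊕ τ)) :=
  {x | (fun i => x (Sum.inl i)) ∈ A ∧ (fun j => x (Sum.inr j)) ∈ B}

theorem isLocallyClosed_affineProd {σ τ : Type} {A : Set (affine σ)} {B : Set (affine τ)}
    (hA : IsLocallyClosed A) (hB : IsLocallyClosed B) : IsLocallyClosed (affineProd A B) :=
  (isLocallyClosed_reindex Sum.inl hA).inter (isLocallyClosed_reindex Sum.inr hB)

/-- A map from a variety to affine space is a morphism as soon as its coordinates are regular, so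
two morphisms combine into one by juxtaposing coordinates, and the projections determine it. -/
theorem isProduct_affineProd {σ τ : Type} {A : Set (affine σ)} {B : Set (affine τ)}
    {X Y P : QPVar} (hX : Isomorphic (restrict (affine σ) A) X.toSpace)
    (hY : Isomorphic (restrict (affine τ) B) Y.toSpace)
    (hP : Isomorphic (restrict (affine (σ ⊕ τ)) (affineProd A B)) P.toSpace) :
    IsProduct X Y P := by
  obtain ⟨eX, hX1, hX2⟩ := hX
  obtain ⟨eY, hY1, hY2⟩ := hY
  obtain ⟨eP, hP1, hP2⟩ := hP
  have i1 : IsMorphism (X := restrict (affine (σ ⊕ τ)) (affineProd A B))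
      (Y := restrict (affine σ) A) (fun x => ⟨fun i => x.1 (Sum.inl i), x.2.1⟩) :=
    IsMorphism.codRestrict _ ((isMorphism_reindex Sum.inl).comp isMorphism_val)
  have i2 : IsMorphism (X := restrict (affine (σ ⊕ τ)) (affineProd A B))
      (Y := restrict (affine τ) B) (fun x => ⟨fun i => x.1 (Sum.inr i), x.2.2⟩) :=
    IsMorphism.codRestrict _ ((isMorphism_reindex Sum.inr).comp isMorphism_val)
  refine ⟨_, _, hX1.comp (i1.comp hP2), hY1.comp (i2.comp hP2), fun T f g hf hg => ?_⟩
  have j1 : IsMorphism (X := T.toSpace) (Y := affine σ) (fun t => (eX.symm (f t)).1) :=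
    isMorphism_val.comp (hX2.comp hf)
  have j2 : IsMorphism (X := T.toSpace) (Y := affine τ) (fun t => (eY.symm (g t)).1) :=
    isMorphism_val.comp (hY2.comp hg)
  have hmem : ∀ t, (Sum.elim (eX.symm (f t)).1 (eY.symm (g t)).1 : affine (σ ⊕ τ)) ∈
      affineProd A B := fun t => ⟨(eX.symm (f t)).2, (eY.symm (g t)).2⟩
  have j3 : IsMorphism (X := T.toSpace) (Y := affine (σ ⊕ τ))
      (fun t => (Sum.elim (eX.symm (f t)).1 (eY.symm (g t)).1 : σ ⊕ τ → ℂ)) := by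
    refine isMorphism_iff.2 fun t => T.nice.regularMapAt_affine ?_
    rintro (i | j)
    · exact j1.2 _ t (regularAt_coord i _)
    · exact j2.2 _ t (regularAt_coord j _)
  refine ⟨fun t => eP ⟨_, hmem t⟩, ⟨hP1.comp (j3.codRestrict hmem), ?_, ?_⟩, ?_⟩
  · funext t
    have h1 := eP.symm_apply_apply ⟨_, hmem t⟩
    have h2 := eX.apply_symm_apply (f t)
    exact (congrArg (fun x : restrict (affine (σ ⊕ τ)) (affineProd A B) =>
      eX ⟨fun i => x.1 (Sum.inl i), x.2.1⟩) h1).trans h2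
  · funext t
    have h1 := eP.symm_apply_apply ⟨_, hmem t⟩
    have h2 := eY.apply_symm_apply (g t)
    exact (congrArg (fun x : restrict (affine (σ ⊕ τ)) (affineProd A B) =>
      eY ⟨fun i => x.1 (Sum.inr i), x.2.2⟩) h1).trans h2
  · rintro h ⟨-, h1, h2⟩
    funext t
    refine (eP.symm_apply_eq).1 (Subtype.ext ?_)
    have h1' := congrArg Subtype.val (eX.symm_apply_eq.2 (congrFun h1 t).symm)
    have h2' := congrArg Subtype.val (eY.symm_apply_eq.2 (congrFun h2 t).symm)
    funext i
    obtain i | j := i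
    · exact (congrFun h1' i).symm
    · exact (congrFun h2' j).symm

theorem IsPiece.affineProd {σ τ : Type} [Finite σ] [Finite τ] {A : Set (affine σ)}
    {B : Set (affine τ)} {a b : K0} (hA : IsPiece _ A a) (hB : IsPiece _ B b) :
    IsPiece (affine (σ ⊕ τ)) (affineProd A B) (a * b) := by
  obtain ⟨c, hc⟩ := exists_isPiece (isLocallyClosed_affineProd hA.1 hB.1)
  convert hc
  obtain ⟨-, X, hX, rfl⟩ := hA
  obtain ⟨-, Y, hY, rfl⟩ := hB
  obtain ⟨-, P, hP, rfl⟩ := hc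
  exact (varClass_eq_mul (isProduct_affineProd hX hY hP)).symm

theorem IsPiece.eq_one {X : FunSpace} {A : Set X} {c : K0} (h : IsPiece X A c)
    (h1 : ∃! x, x ∈ A) : c = 1 := by
  obtain ⟨-, Q, ⟨e, -⟩, rfl⟩ := h
  obtain ⟨x, hx, hx'⟩ := h1
  refine varClass_eq_one ⟨(e ⟨x, hx⟩).1, (e ⟨x, hx⟩).2, fun y hy => ?_⟩
  have h2 := hx' _ (e.symm ⟨y, hy⟩).2
  have h3 : e.symm ⟨y, hy⟩ = ⟨x, hx⟩ := Subtype.ext h2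
  exact congrArg Subtype.val (e.symm_apply_eq.1 h3)

theorem isPiece_line : IsPiece (affine (Fin 1)) Set.univ lefschetz := by
  obtain ⟨c, hc⟩ := exists_isPiece (σ := Fin 1) (A := Set.univ) isOpen_univ.isLocallyClosed
  rwa [lefschetz, hc.hasClass.cls_eq]

/-- Cutting the line into the origin, of class 1, and its complement. -/
theorem isPiece_punctured_line :
    IsPiece (affine (Fin 1)) {x : affine (Fin 1) | x 0 ≠ 0} (lefschetz - 1) := by
  have ho : IsOpen {x : affine (Fin 1) | x 0 ≠ 0} := by
    exact isOpen_coord_ne 0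
  obtain ⟨c, hc, hs⟩ := isPiece_line.exists_sum
    (fun b : Bool => if b then {x : affine (Fin 1) | x 0 ≠ 0} else {x : affine (Fin 1) | x 0 ≠ 0}ᶜ)
    (by
      rintro (_ | _)
      · exact ho.isClosed_compl.isLocallyClosed
      · exact ho.isLocallyClosed)
    (by
      rintro (_ | _) (_ | _) h
      · exact (h rfl).elim
      · exact disjoint_compl_left
      · exact disjoint_compl_right
      · exact (h rfl).elim)
    (fun x _ => by
      rw [Set.mem_iUnion]
      by_cases h : x 0 ≠ 0
      · exact ⟨true, h⟩
      · exact ⟨false, h⟩)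
  have h0 : c false = 1 := by
    refine (hc false).eq_one ⟨fun _ => (0 : ℂ), ⟨Set.mem_univ _, fun h => h rfl⟩, ?_⟩
    rintro y ⟨-, hy⟩
    funext i
    rw [Subsingleton.elim i 0]
    exact not_not.1 hy
  have h1 := hc true
  rw [Fintype.sum_bool, h0] at hs
  rw [Set.univ_inter] at h1
  rwa [hs, add_sub_cancel_right]

theorem isPiece_affine_univ (m : ℕ) :
    IsPiece (affine (Fin m)) Set.univ (lefschetz ^ m) := by
  induction m with
  | zero =>
    obtain ⟨c, hc⟩ := exists_isPiece (σ := Fin 0) (A := Set.univ) isOpen_univ.isLocallyClosed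
    have := hc.eq_one ⟨fun i => i.elim0, trivial, fun y _ => funext fun i => i.elim0⟩
    rwa [pow_zero, ← this]
  | succ m ih =>
    have := (ih.affineProd isPiece_line).reindex finSumFinEquiv
    rw [pow_succ]
    convert this using 1
    symm
    refine Set.eq_univ_of_forall fun x => ?_
    exact ⟨trivial, trivial⟩

/-- The class of a cylinder over a constructible set. -/
theorem HasClass.cylinder {σ τ ρ : Type} [Finite σ] [Finite τ] (e : σ ⊕ τ ≃ ρ) {S : Set (affine σ)}
    {c : K0} (h : HasClass (affine σ) S c) :
    HasClass (affine ρ) {x : affine ρ | (fun i => x (e (Sum.inl i))) ∈ S}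
      (c * lefschetz ^ Nat.card τ) := by
  obtain ⟨k, A, a, hA, hd, rfl, rfl⟩ := h.exists_pieces
  have hτ : IsPiece (affine τ) Set.univ (lefschetz ^ Nat.card τ) :=
    (isPiece_affine_univ _).reindex (Finite.equivFin τ).symm
  rw [Finset.sum_mul]
  refine HasClass.of_pieces _ _ (fun i => ((hA i).affineProd hτ).reindex e) ?_ ?_
  · intro i j hij
    exact Set.disjoint_left.2 fun x h1 h2 => Set.disjoint_left.1 (hd i j hij) h1.1 h2.1
  · ext x
    simp only [Set.mem_iUnion]
    constructor
    · intro h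
      obtain ⟨i, hi⟩ := Set.mem_iUnion.1 h
      exact ⟨i, hi, trivial⟩
    · rintro ⟨i, hi⟩
      exact Set.mem_iUnion.2 ⟨i, hi.1⟩

/-! ## The factor space of the jets -/

theorem exists_sum_mul_eq_gcd {ι : Type*} (s : Finset ι) (w : ι → ℕ) :
    ∃ u : ι → ℤ, ∑ i ∈ s, u i * w i = (s.gcd w : ℕ) := by
  classical
  induction s using Finset.induction_on with
  | empty => exact ⟨0, by simp⟩
  | insert b s hb ih =>
    obtain ⟨u, hu⟩ := ih
    refine ⟨fun i => if i = b then Nat.gcdA (w b) (s.gcd w) else Nat.gcdB (w b) (s.gcd w) * u i, ?_⟩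
    rw [Finset.sum_insert hb, Finset.gcd_insert]
    have : ∑ i ∈ s, (if i = b then Nat.gcdA (w b) (s.gcd w)
        else Nat.gcdB (w b) (s.gcd w) * u i) * (w i : ℤ) =
        Nat.gcdB (w b) (s.gcd w) * ∑ i ∈ s, u i * w i := by
      rw [Finset.mul_sum]
      refine Finset.sum_congr rfl fun i hi => ?_
      rw [if_neg (fun h : i = b => hb (h ▸ hi)), mul_assoc]
    rw [this, hu]
    beta_reduce
    rw [if_pos rfl]
    change _ = ((Nat.gcd (w b) (s.gcd w) : ℕ) : ℤ)
    rw [Nat.gcd_eq_gcd_ab]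
    ring

/-- Data that split off the orbits of `ℂ*` from the torus of jets with a given support: a monomial
of weight `order`, the greatest common divisor of the weights of the support. -/
structure TorusSplitting (d n : ℕ) where
  supp : Finset (Fin n × Fin d)
  exponent : Fin n × Fin d → ℤ
  weight : Fin n × Fin d → ℕ
  order : ℕ
  order_pos : 0 < order
  eq_mul : ∀ i ∈ supp, (i.1 : ℕ) + 1 = order * weight i
  sum_eq_one : ∑ i ∈ supp, exponent i * weight i = 1

/-- Bézout's relation for the weights of `I`, divided by their gcd; nonemptiness makes the gcd
positive. -/
theorem exists_torusSplitting {d n : ℕ} {I : Finset (Fin n × Fin d)} (hI : I.Nonempty) :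
    ∃ D : TorusSplitting d n, D.supp = I := by
  obtain ⟨u, hu⟩ := exists_sum_mul_eq_gcd I (fun i => (i.1 : ℕ) + 1)
  obtain ⟨w, hw, -⟩ := Finset.extract_gcd (fun i : Fin n × Fin d => (i.1 : ℕ) + 1) hI
  have hpos : 0 < I.gcd (fun i => (i.1 : ℕ) + 1) := by
    obtain ⟨i, hi⟩ := hI
    exact Nat.pos_of_ne_zero (Finset.gcd_ne_zero_iff.2 ⟨i, hi, Nat.succ_ne_zero _⟩)
  refine ⟨⟨I, u, w, _, hpos, hw, ?_⟩, rfl⟩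
  have hne : ((I.gcd (fun i => (i.1 : ℕ) + 1) : ℕ) : ℤ) ≠ 0 := by exact_mod_cast hpos.ne'
  refine mul_left_cancel₀ hne ?_
  rw [mul_one, Finset.mul_sum]
  refine Eq.trans ?_ hu
  refine Finset.sum_congr rfl fun i hi => ?_
  have := congrArg (Nat.cast : ℕ → ℤ) (hw i hi)
  rw [this]
  push_cast
  ring

/-- The factorization map of the punctured jet space. -/
def jetProj {d n : ℕ} (c : JetStar d n) : jetQuotSpace d n :=
  (Quotient.mk _ c : JetQuot d n)

theorem jetProj_eq_iff {d n : ℕ} {c c' : JetStar d n} :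
    jetProj c = jetProj c' ↔ ∃ a : ℂˣ, a • c'.1 = c.1 := by
  refine Quotient.eq.trans ⟨?_, ?_⟩
  · rintro ⟨a, ha⟩
    exact ⟨a, congrArg Subtype.val ha⟩
  · rintro ⟨a, ha⟩
    exact ⟨a, Subtype.ext ha⟩

/-- The preimage in the jet space of a subset of the factor space. -/
def jetCone {d n : ℕ} (B : Set (jetQuotSpace d n)) : Set (jetSpace d n) :=
  {c : Jet d n | ∃ h : c ≠ 0, jetProj ⟨c, h⟩ ∈ B}

theorem smul_mem_jetCone {d n : ℕ} {B : Set (jetQuotSpace d n)} (a : ℂˣ) {c : Jet d n} :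
    a • c ∈ jetCone B ↔ c ∈ jetCone B := by
  constructor
  · rintro ⟨h, h'⟩
    have h0 : c ≠ 0 := fun h1 => h (Jet.smul_eq_zero.2 h1)
    refine ⟨h0, ?_⟩
    have : jetProj ⟨a • c, h⟩ = jetProj ⟨c, h0⟩ := jetProj_eq_iff.2 ⟨a, rfl⟩
    rwa [← this]
  · rintro ⟨h0, h'⟩
    have h : a • c ≠ 0 := fun h1 => h0 (Jet.smul_eq_zero.1 h1)
    refine ⟨h, ?_⟩
    have : jetProj ⟨a • c, h⟩ = jetProj ⟨c, h0⟩ := jetProj_eq_iff.2 ⟨a, rfl⟩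
    rwa [this]

theorem isOpen_jet_ne_zero (d n : ℕ) : 
    IsOpen[(jetSpace d n).top] {c : Jet d n | c ≠ 0} := by
  have : {c : Jet d n | c ≠ 0} =
      ⋃ i : Fin n × Fin d, {c : affine (Fin n × Fin d) | c i ≠ 0} := by
    ext c
    refine Iff.trans ?_ Set.mem_iUnion.symm
    exact Function.ne_iff (f₁ := (c : Fin n × Fin d → ℂ)) (f₂ := fun _ => 0)
  exact (congrArg (fun s => IsOpen[(jetSpace d n).top] s) this).mpr
    (isOpen_iUnion fun i => isOpen_coord_ne i)

theorem isLocallyClosed_jetCone {d n : ℕ} {B : Set (jetQuotSpace d n)} (hB : IsLocallyClosed B) :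
    IsLocallyClosed (jetCone B) := by
  have h1 : IsLocallyClosed ((fun c => jetProj c) ⁻¹' B : Set (restrict (jetSpace d n)
      {c : Jet d n | c ≠ 0})) :=
    hB.preimage (isMorphism_coinduced_mk (X := restrict (jetSpace d n) {c : Jet d n | c ≠ 0})
      (W := JetQuot d n) (fun c : JetStar d n => Quotient.mk _ c)).1
  have h2 := h1.image (f := Subtype.val) Topology.IsInducing.subtypeVal
    (by
      have : Set.range (Subtype.val : {c : Jet d n // c ≠ 0} → Jet d n) = {c | c ≠ 0} :=
        Subtype.range_coe
      exact (congrArg (fun s => IsLocallyClosed (X := jetSpace d n) s) this).mpr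
        (isOpen_jet_ne_zero d n).isLocallyClosed)
  convert h2 using 1
  ext c
  constructor
  · rintro ⟨h, h'⟩
    exact ⟨⟨c, h⟩, h', rfl⟩
  · rintro ⟨⟨c, h⟩, h', rfl⟩
    exact ⟨h, h'⟩

/-- The classes of jets whose coordinate with index `i` does not vanish. -/
def quotChart {d n : ℕ} (i : Fin n × Fin d) : Set (jetQuotSpace d n) :=
  {w | ∀ c : JetStar d n, jetProj c = w → c.1 i ≠ 0}

theorem jetProj_mem_quotChart {d n : ℕ} {i : Fin n × Fin d} (c : JetStar d n) :
    jetProj c ∈ quotChart i ↔ c.1 i ≠ 0 := by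
  refine ⟨fun h => h c rfl, fun h c' hc' => ?_⟩
  obtain ⟨a, ha⟩ := jetProj_eq_iff.1 hc'
  rw [← ha]
  exact mul_ne_zero (pow_ne_zero _ a.ne_zero) h

theorem isOpen_quotChart {d n : ℕ} (i : Fin n × Fin d) :
    IsOpen (quotChart i : Set (jetQuotSpace d n)) := by
  refine isOpen_coinduced.2 ?_
  have h : IsOpen {v : restrict (jetSpace d n) {c : Jet d n | c ≠ 0} |
      v.1 ∈ {x : affine (Fin n × Fin d) | x i ≠ 0}} :=
    (isOpen_coord_ne i).preimage continuous_subtype_val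
  have h' : (fun c : JetStar d n => jetProj c) ⁻¹' quotChart i =
      {v : JetStar d n | v.1 i ≠ 0} := Set.ext fun v => jetProj_mem_quotChart v
  exact (congrArg (fun s => IsOpen[(restrict (jetSpace d n) {c : Jet d n | c ≠ 0}).top] s)
    h').mpr h

/-- The classes of jets with support `I`. -/
def quotStratum {d n : ℕ} (I : Finset (Fin n × Fin d)) : Set (jetQuotSpace d n) :=
  {w | ∀ i, i ∈ I ↔ w ∈ quotChart i}

theorem jetProj_mem_quotStratum {d n : ℕ} {I : Finset (Fin n × Fin d)} (c : JetStar d n) :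
    jetProj c ∈ quotStratum I ↔ ∀ i, i ∈ I ↔ c.1 i ≠ 0 :=
  forall_congr' fun _ => iff_congr Iff.rfl (jetProj_mem_quotChart c)

theorem isLocallyClosed_quotStratum {d n : ℕ} (I : Finset (Fin n × Fin d)) :
    IsLocallyClosed (quotStratum I : Set (jetQuotSpace d n)) := by
  classical
  have : (quotStratum I : Set (jetQuotSpace d n)) =
      (⋂ i ∈ I, quotChart i) ∩ ⋂ i ∈ Iᶜ, (quotChart i)ᶜ := by
    ext w
    simp only [quotStratum, Set.mem_ofPred_eq, Set.mem_inter_iff, Set.mem_iInter, Set.mem_compl_iff,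
      Finset.mem_compl]
    exact ⟨fun h => ⟨fun i => (h i).1, fun i hi h' => hi ((h i).2 h')⟩,
      fun h i => ⟨h.1 i, fun h' => by_contra fun hi => h.2 i hi h'⟩⟩
  rw [this]
  refine (isOpen_biInter_finset fun i _ => isOpen_quotChart i).isLocallyClosed.inter ?_
  exact (isClosed_biInter fun i _ => (isOpen_quotChart i).isClosed_compl).isLocallyClosed

theorem disjoint_quotStratum {d n : ℕ} {I J : Finset (Fin n × Fin d)} (h : I ≠ J) :
    Disjoint (quotStratum I : Set (jetQuotSpace d n)) (quotStratum J) :=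
  Set.disjoint_left.2 fun _ h1 h2 => h (Finset.ext fun i => (h1 i).trans (h2 i).symm)

theorem exists_mem_quotStratum {d n : ℕ} (w : jetQuotSpace d n) :
    ∃ I : Finset (Fin n × Fin d), I.Nonempty ∧ w ∈ quotStratum I := by
  classical
  obtain ⟨c, hc⟩ := Quotient.exists_rep w
  change jetProj c = w at hc
  subst hc
  refine ⟨Finset.univ.filter fun i => c.1 i ≠ 0, ?_, ?_⟩
  · obtain ⟨i, hi⟩ := Function.ne_iff.1 c.2
    exact ⟨i, Finset.mem_filter.2 ⟨Finset.mem_univ _, hi⟩⟩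
  · exact (jetProj_mem_quotStratum c).2 fun i => by simp

/-! ### Trivializing the orbits of jets with a fixed support. -/

namespace TorusSplitting

variable {d n : ℕ} (D : TorusSplitting d n)

/-- The monomial of a splitting. -/
def mon (x : Jet d n) : ℂ := ∏ i ∈ D.supp, x i ^ D.exponent i

open scoped Classical in
/-- The point of the orbit of a jet where the monomial of the splitting is `1`. -/
def normalize (x : Jet d n) : Jet d n :=
  fun i => if i ∈ D.supp then D.mon x ^ (-(D.weight i : ℤ)) * x i else 0

/-- The jets with the support of the splitting. -/
def HasSupp (x : Jet d n) : Prop := ∀ i, i ∈ D.supp ↔ x i ≠ 0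

variable {D}

theorem HasSupp.ne_zero {x : Jet d n} (hx : D.HasSupp x) : x ≠ 0 := by
  rintro rfl
  have h : D.supp = ∅ := Finset.eq_empty_of_forall_notMem fun i hi => (hx i).1 hi rfl
  have := D.sum_eq_one
  simp [h] at this

theorem hasSupp_iff {x : Jet d n} : D.HasSupp x ↔ x ∈ jetCone (quotStratum D.supp) :=
  ⟨fun h => ⟨h.ne_zero, (jetProj_mem_quotStratum _).2 h⟩,
    fun ⟨h, h'⟩ => (jetProj_mem_quotStratum ⟨x, h⟩).1 h'⟩

theorem HasSupp.mon_ne_zero {x : Jet d n} (hx : D.HasSupp x) : D.mon x ≠ 0 :=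
  Finset.prod_ne_zero_iff.2 fun i hi => zpow_ne_zero _ ((hx i).1 hi)

variable (D)

theorem mon_smul (a : ℂˣ) (x : Jet d n) : D.mon (a • x) = (a : ℂ) ^ D.order * D.mon x := by
  have h1 : ∀ i ∈ D.supp, (a • x) i ^ D.exponent i =
      ((a : ℂ) ^ D.order) ^ (D.exponent i * D.weight i) * x i ^ D.exponent i := by
    intro i hi
    change ((a : ℂ) ^ ((i.1 : ℕ) + 1) * x i) ^ D.exponent i = _
    rw [mul_zpow, D.eq_mul i hi, pow_mul, mul_comm (D.exponent i), zpow_mul, zpow_natCast]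
  have h2 : (a : ℂ) ^ D.order ≠ 0 := pow_ne_zero _ a.ne_zero
  have h3 : ∀ s : Finset (Fin n × Fin d), ∏ i ∈ s, ((a : ℂ) ^ D.order) ^
      (D.exponent i * D.weight i) = ((a : ℂ) ^ D.order) ^ ∑ i ∈ s, D.exponent i * D.weight i := by
    classical
    intro s
    induction s using Finset.induction_on with
    | empty => simp
    | insert i s hi ih => rw [Finset.prod_insert hi, Finset.sum_insert hi, zpow_add₀ h2, ih]
  rw [mon, Finset.prod_congr rfl h1, Finset.prod_mul_distrib, h3, D.sum_eq_one, zpow_one, mon]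

/-- The factor `mon ^ (-weight i)` has weight `-(order * weight i)`, which cancels the weight of the
coordinate `i`. -/
theorem normalize_smul (a : ℂˣ) (x : Jet d n) : D.normalize (a • x) = D.normalize x := by
  funext i
  by_cases hi : i ∈ D.supp
  · simp only [normalize, if_pos hi, mon_smul]
    change _ * ((a : ℂ) ^ ((i.1 : ℕ) + 1) * x i) = _
    have h2 : ((a : ℂ) ^ D.order) ^ D.weight i ≠ 0 := pow_ne_zero _ (pow_ne_zero _ a.ne_zero)
    rw [D.eq_mul i hi, pow_mul, mul_zpow, zpow_neg, zpow_natCast]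
    field_simp
  · simp only [normalize, if_neg hi]

variable {D}

/-- All weights on the support are multiples of `order`, so `a` acts only through `s = a ^ order`.
Root extraction, which is not algebraic, thus drops out of the formulas: the right-hand side is
polynomial in `s`. -/
theorem smul_eq_of_pow_eq {x : Jet d n} (hx : D.HasSupp x) {a : ℂˣ} {s : ℂ}
    (ha : (a : ℂ) ^ D.order = s) : a • x = fun i => s ^ D.weight i * x i := by
  funext i
  change (a : ℂ) ^ ((i.1 : ℕ) + 1) * x i = _
  by_cases hi : i ∈ D.supp
  · rw [D.eq_mul i hi, pow_mul, ha]
  · rw [not_not.1 (mt (hx i).2 hi), mul_zero, mul_zero]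

theorem exists_unit_pow_eq (D : TorusSplitting d n) {s : ℂ} (hs : s ≠ 0) :
    ∃ a : ℂˣ, (a : ℂ) ^ D.order = s := by
  obtain ⟨z, hz⟩ := IsAlgClosed.exists_pow_nat_eq s D.order_pos
  have hz0 : z ≠ 0 := by
    rintro rfl
    exact hs (by rw [← hz, zero_pow D.order_pos.ne'])
  exact ⟨Units.mk0 z hz0, hz⟩

theorem HasSupp.exists_normalize_eq_smul {x : Jet d n} (hx : D.HasSupp x) :
    ∃ a : ℂˣ, D.normalize x = a • x ∧ D.mon (D.normalize x) = 1 := by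
  -- Acting by a root of order `order` of the inverse of the monomial makes the monomial equal to 1.
  obtain ⟨a, ha⟩ := D.exists_unit_pow_eq (inv_ne_zero hx.mon_ne_zero)
  have h : D.normalize x = a • x := by
    rw [smul_eq_of_pow_eq hx ha]
    funext i
    by_cases hi : i ∈ D.supp
    · simp only [normalize, if_pos hi, zpow_neg, zpow_natCast, inv_pow]
    · simp only [normalize, if_neg hi, not_not.1 (mt (hx i).2 hi), mul_zero]
  refine ⟨a, h, ?_⟩
  rw [h, mon_smul, ha, inv_mul_cancel₀ hx.mon_ne_zero]

theorem HasSupp.normalize_eq_self {x : Jet d n} (hx : D.HasSupp x) (h1 : D.mon x = 1) :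
    D.normalize x = x := by
  funext i
  by_cases hi : i ∈ D.supp
  · simp only [normalize, if_pos hi, h1, one_zpow, one_mul]
  · simp only [normalize, if_neg hi, not_not.1 (mt (hx i).2 hi)]

theorem regularAt_mon {x : affine (Fin n × Fin d)} (hx : ∀ i ∈ D.supp, x i ≠ 0) :
    (affine (Fin n × Fin d)).RegularAt D.mon x :=
  (nice_affine _).prod _ fun i hi => (nice_affine _).zpow (regularAt_coord i x) (hx i hi) _

theorem regularMapAt_normalize {x : affine (Fin n × Fin d)} (hx : ∀ i ∈ D.supp, x i ≠ 0) :
    RegularMapAt (X := affine (Fin n × Fin d)) (Y := affine (Fin n × Fin d)) D.normalize x := by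
  refine (nice_affine _).regularMapAt_affine fun i => ?_
  by_cases hi : i ∈ D.supp
  · have h : (fun z : Jet d n => D.normalize z i) =
        fun z => D.mon z ^ (-(D.weight i : ℤ)) * z i := by
      funext z
      simp only [normalize, if_pos hi]
    exact h ▸ (nice_affine _).mul _ _ _ ((nice_affine _).zpow (regularAt_mon hx)
      (Finset.prod_ne_zero_iff.2 fun i hi => zpow_ne_zero _ (hx i hi)) _) (regularAt_coord i x)
  · have h : (fun z : Jet d n => D.normalize z i) = fun z => 0 := by
      funext z
      simp only [normalize, if_neg hi]
    exact h ▸ (nice_affine _).const 0 x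

variable (D)

/-- The normalized jets over a subset of the factor space. -/
def slice (B : Set (jetQuotSpace d n)) : Set (affine (Fin n × Fin d)) :=
  {x | x ∈ jetCone B ∧ D.mon x = 1}

variable {D} {B : Set (jetQuotSpace d n)}

theorem hasSupp_of_mem (hB : B ⊆ quotStratum D.supp) {x : Jet d n} (hx : x ∈ jetCone B) :
    D.HasSupp x :=
  hasSupp_iff.2 ⟨hx.1, hB hx.2⟩

theorem normalize_mem_slice (hB : B ⊆ quotStratum D.supp) {x : Jet d n} (hx : x ∈ jetCone B) :
    D.normalize x ∈ D.slice B := by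
  obtain ⟨a, ha, h1⟩ := (hasSupp_of_mem hB hx).exists_normalize_eq_smul
  refine ⟨?_, h1⟩
  rw [ha]
  exact (smul_mem_jetCone a).2 hx

theorem isLocallyClosed_slice (hB : B ⊆ quotStratum D.supp) (hBl : IsLocallyClosed B) :
    IsLocallyClosed (D.slice B) := by
  have h1 : IsClosed {y : affine (Fin 1) | y 0 = 1} := by
    have h := (isOpen_eval_ne (MvPolynomial.X (0 : Fin 1) - 1)).isClosed_compl
    have h2 : {y : affine (Fin 1) | y 0 = 1} =
        {y | MvPolynomial.eval y (MvPolynomial.X (0 : Fin 1) - 1) ≠ 0}ᶜ := by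
      refine Set.ext fun y => ?_
      have h3 : ∀ y : Fin 1 → ℂ, MvPolynomial.eval y (MvPolynomial.X (0 : Fin 1) - 1) = y 0 - 1 :=
        fun y => by rw [map_sub, MvPolynomial.eval_X, map_one]
      refine Iff.trans ?_ not_not.symm
      exact sub_eq_zero.symm.trans (Eq.congr_left (h3 y).symm)
    rwa [h2]
  exact isLocallyClosed_inter_preimage (X := affine (Fin n × Fin d)) (Y := affine (Fin 1))
    (a := fun x _ => D.mon x) (isLocallyClosed_jetCone hBl)
    (fun x hx => ((nice_affine _).regularMapAt_affine fun _ => regularAt_mon fun i hi =>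
      (hasSupp_of_mem hB hx i).1 hi).1.continuousWithinAt) h1.isLocallyClosed

/-- The normalization of jets on the factor space. -/
def quotNormalize (D : TorusSplitting d n) : jetQuotSpace d n → affine (Fin n × Fin d) :=
  Quotient.lift (fun c : JetStar d n => D.normalize c.1) (by
    rintro c c' ⟨a, rfl⟩
    exact D.normalize_smul a c'.1)

/-- Being constant on orbits, normalization descends to the factor space, where it inverts the
projection of the slice. -/
theorem isomorphic_slice (hB : B ⊆ quotStratum D.supp) :
    Isomorphic (restrict (jetQuotSpace d n) B) (restrict (affine (Fin n × Fin d)) (D.slice B)) := by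
  have hg : IsMorphism (X := restrict (affine (Fin n × Fin d)) (D.slice B)) (Y := jetQuotSpace d n)
      (fun y => jetProj ⟨y.1, y.2.1.1⟩) :=
    (isMorphism_coinduced_mk (X := restrict (jetSpace d n) {c : Jet d n | c ≠ 0})
      (W := JetQuot d n) (fun c : JetStar d n => Quotient.mk _ c)).comp
      (IsMorphism.codRestrict (X := jetSpace d n) (S := {c : Jet d n | c ≠ 0})
        (fun y : restrict (affine (Fin n × Fin d)) (D.slice B) => y.2.1.1) isMorphism_val)
  have hcone : ∀ c : JetStar d n, jetProj c ∈ B → c.1 ∈ jetCone B := fun c hc => ⟨c.2, hc⟩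
  refine isomorphic_restrict D.quotNormalize _ ?_ ?_ hg (fun y => y.2.1.2) ?_ ?_
  · intro w hw
    -- Normalization is regular on this open neighbourhood of `B`, where jets may also have further
    -- nonzero coordinates.
    have hU : IsOpen (⋂ i ∈ D.supp, (quotChart i : Set (jetQuotSpace d n))) :=
      isOpen_biInter_finset fun i _ => isOpen_quotChart i
    refine regularMapAt_coinduced hU ?_ (Set.mem_iInter₂.2 fun i hi => (hB hw i).1 hi)
    intro c hc
    refine RegularMapAt.comp (X := restrict (jetSpace d n) {c : Jet d n | c ≠ 0})
      (Y := affine (Fin n × Fin d)) (Z := affine (Fin n × Fin d)) (g := D.normalize)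
      (f := fun c => c.1) (regularMapAt_normalize fun i hi => ?_)
      (isMorphism_iff.1 isMorphism_val c)
    exact (jetProj_mem_quotChart c).1 (Set.mem_iInter₂.1 hc i hi)
  · intro w hw
    obtain ⟨c, rfl⟩ := Quotient.exists_rep w
    exact normalize_mem_slice hB (hcone c hw)
  · intro w hw
    obtain ⟨c, rfl⟩ := Quotient.exists_rep w
    obtain ⟨a, ha, -⟩ := (hasSupp_of_mem hB (hcone c hw)).exists_normalize_eq_smul
    exact jetProj_eq_iff.2 ⟨a, ha.symm⟩
  · intro y
    exact (hasSupp_of_mem hB y.2.1).normalize_eq_self y.2.2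

/-- The second factor is the value s of the monomial, a coordinate on ℂ* modulo the roots of unity
acting trivially. The inverse multiplies the coordinate `i` of the slice by `s ^ weight i`. -/
theorem isomorphic_jetCone (hB : B ⊆ quotStratum D.supp) :
    Isomorphic (restrict (affine (Fin n × Fin d)) (jetCone B))
      (restrict (affine ((Fin n × Fin d) ⊕ Fin 1))
        (affineProd (D.slice B) {x : affine (Fin 1) | x 0 ≠ 0})) := by
  have hg : IsMorphism (X := affine ((Fin n × Fin d) ⊕ Fin 1)) (Y := affine (Fin n × Fin d))
      (fun y i => y (Sum.inr 0) ^ D.weight i * y (Sum.inl i)) :=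
    isMorphism_iff.2 fun y => (nice_affine _).regularMapAt_affine fun i =>
      (nice_affine _).mul _ _ _ ((nice_affine _).pow (regularAt_coord _ y) _)
        (regularAt_coord _ y)
  have key : ∀ y : Jet d n, y ∈ D.slice B → ∀ s : ℂ, s ≠ 0 → ∃ a : ℂˣ, (a : ℂ) ^ D.order = s ∧
      (fun i => s ^ D.weight i * y i) = a • y := by
    intro y hy s hs
    obtain ⟨a, ha⟩ := D.exists_unit_pow_eq hs
    exact ⟨a, ha, (smul_eq_of_pow_eq (hasSupp_of_mem hB hy.1) ha).symm⟩
  refine isomorphic_restrict (X := affine (Fin n × Fin d)) (Y := affine ((Fin n × Fin d) ⊕ Fin 1))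
    (fun x => (Sum.elim (D.normalize x) (fun _ => D.mon x) : (Fin n × Fin d) ⊕ Fin 1 → ℂ)) _
    ?_ ?_ (hg.comp isMorphism_val) ?_ ?_ ?_
  · intro x hx
    have hs : ∀ i ∈ D.supp, x i ≠ 0 := fun i hi => (hasSupp_of_mem hB hx i).1 hi
    refine (nice_affine _).regularMapAt_affine ?_
    rintro (i | i)
    · exact (regularMapAt_normalize hs).2 _ (regularAt_coord i _)
    · exact regularAt_mon hs
  · intro x hx
    exact ⟨normalize_mem_slice hB hx, (hasSupp_of_mem hB hx).mon_ne_zero⟩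
  · intro y
    obtain ⟨a, -, ha⟩ := key _ y.2.1 _ y.2.2
    change (fun i => y.1 (Sum.inr 0) ^ D.weight i * y.1 (Sum.inl i)) ∈ jetCone B
    rw [ha]
    exact (smul_mem_jetCone a).2 y.2.1.1
  · intro x hx
    have hx' := hasSupp_of_mem hB hx
    funext i
    change D.mon x ^ D.weight i * D.normalize x i = x i
    by_cases hi : i ∈ D.supp
    · simp only [normalize, if_pos hi, zpow_neg, zpow_natCast]
      exact mul_inv_cancel_left₀ (pow_ne_zero _ hx'.mon_ne_zero) _
    · simp only [normalize, if_neg hi, mul_zero]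
      exact (not_not.1 (mt (hx' i).2 hi)).symm
  · intro y
    obtain ⟨a, ha, ha'⟩ := key _ y.2.1 _ y.2.2
    have h1 := y.2.1
    have h2 : ∀ z' z : Jet d n, z' = a • z →
        D.normalize z' = D.normalize z ∧ D.mon z' = (a : ℂ) ^ D.order * D.mon z := by
      rintro _ z rfl
      exact ⟨D.normalize_smul a z, D.mon_smul a z⟩
    obtain ⟨e1, e2⟩ := h2 _ _ ha'
    funext i
    obtain i | i := i
    · exact congrFun (e1.trans ((hasSupp_of_mem hB h1.1).normalize_eq_self h1.2)) i
    · refine e2.trans ((congrArg ((a : ℂ) ^ D.order * ·) h1.2).trans ?_)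
      rw [Subsingleton.elim i 0]
      exact (mul_one _).trans ha

theorem exists_isPiece_quot (hB : B ⊆ quotStratum D.supp) (hBl : IsLocallyClosed B) :
    ∃ c, IsPiece (jetQuotSpace d n) B c := by
  obtain ⟨c, hc⟩ := exists_isPiece (isLocallyClosed_slice hB hBl)
  exact ⟨c, hc.of_isomorphic hBl (isomorphic_slice hB).symm⟩

theorem isPiece_jetCone (hB : B ⊆ quotStratum D.supp) {c : K0}
    (h : IsPiece (jetQuotSpace d n) B c) :
    IsPiece (jetSpace d n) (jetCone B) (c * (lefschetz - 1)) :=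
  ((h.of_isomorphic (isLocallyClosed_slice hB h.1) (isomorphic_slice hB)).affineProd
    isPiece_punctured_line).of_isomorphic (isLocallyClosed_jetCone h.1) (isomorphic_jetCone hB).symm

end TorusSplitting

/-! ### Classes of constructible sets of orbits and of their cones. -/

theorem exists_isPiece_of_subset_quotStratum {d n : ℕ} {I : Finset (Fin n × Fin d)}
    (hI : I.Nonempty) {B : Set (jetQuotSpace d n)} (hB : B ⊆ quotStratum I)
    (hBl : IsLocallyClosed B) : ∃ c, IsPiece (jetQuotSpace d n) B c := by
  obtain ⟨D, rfl⟩ := exists_torusSplitting hI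
  exact TorusSplitting.exists_isPiece_quot hB hBl

theorem IsPiece.jetCone {d n : ℕ} {I : Finset (Fin n × Fin d)}
    (hI : I.Nonempty) {B : Set (jetQuotSpace d n)} (hB : B ⊆ quotStratum I) {c : K0}
    (h : IsPiece (jetQuotSpace d n) B c) :
    IsPiece (jetSpace d n) (jetCone B) (c * (lefschetz - 1)) := by
  obtain ⟨D, rfl⟩ := exists_torusSplitting hI
  exact TorusSplitting.isPiece_jetCone hB h

theorem disjoint_jetCone {d n : ℕ} {B B' : Set (jetQuotSpace d n)} (h : Disjoint B B') :
    Disjoint (jetCone B) (jetCone B') :=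
  Set.disjoint_left.2 fun _ h1 h2 => Set.disjoint_left.1 h h1.2 h2.2

theorem jetCone_iUnion {d n : ℕ} {ι : Type*} (B : ι → Set (jetQuotSpace d n)) :
    jetCone (⋃ i, B i) = ⋃ i, jetCone (B i) := by
  ext c
  refine Iff.trans ?_ Set.mem_iUnion.symm
  constructor
  · rintro ⟨h, h'⟩
    obtain ⟨i, hi⟩ := Set.mem_iUnion.1 h'
    exact ⟨i, h, hi⟩
  · rintro ⟨i, h, h'⟩
    exact ⟨h, Set.mem_iUnion.2 ⟨i, h'⟩⟩

theorem disjoint_inter_quotStratum {d n k : ℕ} {A : Fin k → Set (jetQuotSpace d n)}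
    (hd : ∀ i j, i ≠ j → Disjoint (A i) (A j))
    (i j : Fin k × {I : Finset (Fin n × Fin d) // I.Nonempty}) (hij : i ≠ j) :
    Disjoint (A i.1 ∩ quotStratum i.2.1) (A j.1 ∩ quotStratum j.2.1) := by
  refine Set.disjoint_left.2 ?_
  rintro w ⟨h1, h2⟩ ⟨h3, h4⟩
  have e1 : i.1 = j.1 := by
    by_contra h
    exact Set.disjoint_left.1 (hd _ _ h) h1 h3
  have e2 : i.2 = j.2 := by
    by_contra h
    exact Set.disjoint_left.1 (disjoint_quotStratum (fun h' => h (Subtype.ext h'))) h2 h4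
  exact hij (Prod.ext e1 e2)

theorem iUnion_eq_iUnion_inter_quotStratum {d n k : ℕ} (A : Fin k → Set (jetQuotSpace d n)) :
    ⋃ i, A i = ⋃ i : Fin k × {I : Finset (Fin n × Fin d) // I.Nonempty},
      A i.1 ∩ quotStratum i.2.1 := by
  ext w
  simp only [Set.mem_iUnion]
  constructor
  · rintro ⟨i, hi⟩
    obtain ⟨I, hI, hw⟩ := exists_mem_quotStratum w
    exact ⟨(i, ⟨I, hI⟩), hi, hw⟩
  · rintro ⟨i, hi, -⟩
    exact ⟨i.1, hi⟩

/-- The class of the cone over a subset of the factor space. -/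
theorem HasClass.jetCone {d n : ℕ} {Y : Set (jetQuotSpace d n)} {c : K0}
    (h : HasClass (jetQuotSpace d n) Y c) :
    HasClass (jetSpace d n) (jetCone Y) (c * (lefschetz - 1)) := by
  classical
  obtain ⟨k, A, a, hA, hd, rfl, rfl⟩ := h.exists_pieces
  -- Each piece is refined by support, since the cone is trivialized only over a single stratum.
  have h1 : ∀ i, ∃ f : {I : Finset (Fin n × Fin d) // I.Nonempty} → K0,
      (∀ I, IsPiece _ (A i ∩ quotStratum I.1) (f I)) ∧ a i = ∑ I, f I := fun i =>
    (hA i).exists_sum _ (fun I => isLocallyClosed_quotStratum I.1)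
      (fun I J hIJ => disjoint_quotStratum fun h' => hIJ (Subtype.ext h')) fun w _ => by
        obtain ⟨I, hI, hw⟩ := exists_mem_quotStratum w
        exact Set.mem_iUnion.2 ⟨⟨I, hI⟩, hw⟩
  choose f hf hf' using h1
  have h2 : (∑ i, a i) * (lefschetz - 1) =
      ∑ i : Fin k × {I : Finset (Fin n × Fin d) // I.Nonempty}, f i.1 i.2 * (lefschetz - 1) := by
    rw [← Finset.sum_mul, Fintype.sum_prod_type]
    simp_rw [hf']
  rw [h2, iUnion_eq_iUnion_inter_quotStratum, jetCone_iUnion]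
  exact HasClass.of_pieces _ _
    (fun i => (hf i.1 i.2).jetCone i.2.2 Set.inter_subset_right)
    (fun i j hij => disjoint_jetCone (disjoint_inter_quotStratum hd i j hij)) rfl

theorem exists_hasClass_quot {d n : ℕ} {Y : Set (jetQuotSpace d n)}
    (hY : Topology.IsConstructible Y) : ∃ c, HasClass (jetQuotSpace d n) Y c := by
  classical
  obtain ⟨k, A, hA, hd, rfl⟩ := exists_iUnion_of_isConstructible hY
  have h1 : ∀ i : Fin k × {I : Finset (Fin n × Fin d) // I.Nonempty},
      ∃ c, IsPiece _ (A i.1 ∩ quotStratum i.2.1) c := fun i =>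
    exists_isPiece_of_subset_quotStratum i.2.2 Set.inter_subset_right
      ((hA _).inter (isLocallyClosed_quotStratum _))
  choose c hc using h1
  exact ⟨_, HasClass.of_pieces _ c hc (disjoint_inter_quotStratum hd)
    (iUnion_eq_iUnion_inter_quotStratum A)⟩

/-- Locally closed parts pull back to locally closed cones, and these are constructible because the
jet space is Noetherian. -/
theorem isConstructible_jetCone {d n : ℕ} {Y : Set (jetQuotSpace d n)}
    (hY : Topology.IsConstructible Y) : Topology.IsConstructible (jetCone Y) := by
  obtain ⟨k, A, hA, -, rfl⟩ := exists_iUnion_of_isConstructible hY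
  rw [jetCone_iUnion]
  have : TopologicalSpace.NoetherianSpace (jetSpace d n) := noetherianSpace_affine _
  exact Topology.IsConstructible.iUnion fun i =>
    IsLocallyClosed.isConstructible (isLocallyClosed_jetCone (hA i))

theorem exists_hasClass_affine {σ : Type} [Finite σ] {Y : Set (affine σ)}
    (hY : Topology.IsConstructible Y) : ∃ c, HasClass (affine σ) Y c := by
  obtain ⟨k, A, hA, hd, rfl⟩ := exists_iUnion_of_isConstructible hY
  choose c hc using fun i => exists_isPiece (hA i)
  exact ⟨_, HasClass.of_pieces A c hc hd rfl⟩

/-! ## The motivic measure of arcs -/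

theorem jet_surjective {d : ℕ} (n : ℕ) : Function.Surjective (jet n : Arc d → Jet d n) := by
  intro c
  -- A polynomial arc: the entry `k - 1` of the jet is the coefficient of degree `k`, and the
  -- constant term is zero.
  refine ⟨⟨fun j => PowerSeries.mk fun k =>
    if h : 0 < k ∧ k - 1 < n then c (⟨k - 1, h.2⟩, j) else 0, fun j => ⟨?_, 1, one_pos, ?_⟩⟩, ?_⟩
  · rw [← PowerSeries.coeff_zero_eq_constantCoeff_apply, PowerSeries.coeff_mk, dif_neg]
    exact fun h => h.1.ne rfl
  · refine summable_of_ne_finset_zero (s := Finset.range (n + 1)) fun k hk => ?_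
    rw [PowerSeries.coeff_mk, dif_neg, norm_zero, zero_mul]
    rintro ⟨h1, h2⟩
    rw [Finset.mem_range] at hk
    omega
  · funext i
    exact (PowerSeries.coeff_mk ((i.1 : ℕ) + 1) fun k =>
      if h : 0 < k ∧ k - 1 < n then c (⟨k - 1, h.2⟩, i.2) else 0).trans
        (dif_pos ⟨Nat.succ_pos _, i.1.2⟩)

/-- The coordinates of longer jets split into those of shorter jets and the remaining ones. -/
def jetIndexEquiv (d n m : ℕ) : (Fin n × Fin d) ⊕ (Fin m × Fin d) ≃ Fin (n + m) × Fin d :=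
  (Equiv.sumProdDistrib _ _ _).symm.trans (finSumFinEquiv.prodCongr (Equiv.refl _))

theorem overLPow_mul (c : K0) (k l : ℕ) :
    overLPow (c * lefschetz ^ l) (k + l) = overLPow c k := by
  refine Localization.mk_eq_mk_iff.2 (Localization.r_iff_exists.2 ⟨1, ?_⟩)
  simp only [OneMemClass.coe_one, one_mul]
  ring

/-- Since every jet lifts to an arc, `Y'` is forced to be the cylinder over `Y`; its class gains the
factor 𝕃^(dm), absorbed by the larger denominator. -/
theorem overLPow_cls_eq {d n m : ℕ} {Y : Set (jetSpace d n)} {Y' : Set (jetSpace d (n + m))}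
    (hY : Topology.IsConstructible Y)
    (h : {φ : Arc d | jet n φ ∈ Y} = {φ | jet (n + m) φ ∈ Y'}) :
    overLPow (cls (jetSpace d n) Y) (d * n) =
      overLPow (cls (jetSpace d (n + m)) Y') (d * (n + m)) := by
  obtain ⟨c, hc⟩ := exists_hasClass_affine (σ := Fin n × Fin d) hY
  have h' : Y' = {x : affine (Fin (n + m) × Fin d) |
      (fun i => x (jetIndexEquiv d n m (Sum.inl i))) ∈ Y} := by
    ext x
    obtain ⟨φ, rfl⟩ := jet_surjective (d := d) (n + m) x
    exact (Set.ext_iff.1 h φ).symm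
  have hc' : HasClass (jetSpace d (n + m)) Y' (c * lefschetz ^ Nat.card (Fin m × Fin d)) :=
    h' ▸ hc.cylinder (jetIndexEquiv d n m)
  have e1 : cls (jetSpace d n) Y = c := hc.cls_eq
  rw [hc'.cls_eq, e1, mul_add, ← overLPow_mul c (d * n) (d * m)]
  congr 3
  simp [mul_comm]

theorem HasMeasureArc.unique {d : ℕ} {X : Set (Arc d)} {v v' : K0Loc} (h : HasMeasureArc X v)
    (h' : HasMeasureArc X v') : v = v' := by
  obtain ⟨n, Y, hY, hX, rfl⟩ := h
  obtain ⟨n', Y', hY', hX', rfl⟩ := h'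
  rcases le_total n n' with hn | hn
  · obtain ⟨m, rfl⟩ := Nat.exists_eq_add_of_le hn
    exact overLPow_cls_eq hY (hX.symm.trans hX')
  · obtain ⟨m, rfl⟩ := Nat.exists_eq_add_of_le hn
    exact (overLPow_cls_eq hY' (hX'.symm.trans hX)).symm

theorem HasMeasureArc.chiArc_eq {d : ℕ} {X : Set (Arc d)} {v : K0Loc} (h : HasMeasureArc X v) :
    chiArc X = v := by
  have h' : ∃ v, HasMeasureArc X v := ⟨v, h⟩
  rw [chiArc, dif_pos h']
  exact h'.choose_spec.unique h

theorem overLPow_mul_sub_one (c : K0) (k : ℕ) :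
    overLPow (c * (lefschetz - 1)) k = (LL - 1) * overLPow c k := by
  have h : LL - 1 = algebraMap K0 K0Loc (lefschetz - 1) := by rw [map_sub, map_one, LL]
  rw [h, overLPow, overLPow, ← Localization.mk_one_eq_algebraMap, Localization.mk_mul, one_mul,
    mul_comm]

/-! ### Cones of arcs and comparison of the integrals. -/

/-- The arcs that are nonzero and whose class belongs to a given set. -/
def arcCone {d : ℕ} (X : Set (ArcQuot d)) : Set (Arc d) :=
  {φ | ∃ h : φ ≠ 0, arcProj ⟨φ, h⟩ ∈ X}

/-- A nonzero arc with vanishing jet is sent by `piQuot` to the added point `none`, which never lies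
over `Y`; this matches the exclusion of the zero jet from the cone. -/
theorem jet_mem_jetCone_iff {d n : ℕ} {Y : Set (jetQuotSpace d n)} (φ : Arc d) :
    jet n φ ∈ jetCone Y ↔ φ ∈ arcCone {x | ∃ y ∈ Y, piQuot n x = some y} := by
  have hpi : ∀ (h : φ ≠ 0) (h' : jet n φ ≠ 0), piQuot n (arcProj ⟨φ, h⟩) =
      some (jetProj ⟨jet n φ, h'⟩ : JetQuot d n) := fun h h' => dif_pos h'
  constructor
  · rintro ⟨h', hY⟩
    have h : φ ≠ 0 := by
      rintro rfl
      exact h' (funext fun i => map_zero (PowerSeries.coeff ((i.1 : ℕ) + 1)))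
    exact ⟨h, _, hY, hpi h h'⟩
  · rintro ⟨h, y, hy, hpy⟩
    by_cases h' : jet n φ = 0
    · have h2 : piQuot n (arcProj ⟨φ, h⟩) = none := dif_neg (not_not.2 h')
      rw [h2] at hpy
      exact (Option.some_ne_none _ hpy.symm).elim
    · have h2 := Option.some_injective _ ((hpi h h').symm.trans hpy)
      refine ⟨h', ?_⟩
      have h3 : jetProj ⟨jet n φ, h'⟩ = y := h2
      rwa [h3]

/-- The measure of the cone over a cylindric set. -/
theorem HasMeasureQuot.arcCone {d : ℕ} {X : Set (ArcQuot d)} {v : K0Loc}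
    (h : HasMeasureQuot X v) : HasMeasureArc (arcCone X) ((LL - 1) * v) := by
  obtain ⟨n, Y, hY, rfl, rfl⟩ := h
  obtain ⟨c, hc⟩ := exists_hasClass_quot hY
  refine ⟨n, jetCone Y, isConstructible_jetCone hY, ?_, ?_⟩
  · ext φ
    exact (jet_mem_jetCone_iff φ).symm
  · rw [hc.cls_eq, hc.jetCone.cls_eq, overLPow_mul_sub_one]

/-- Whatever presentation the choice in `chiQuot` picked, it yields one of the cone, and measures of
arcs are unique. Uniqueness on the quotient is therefore not needed. -/
theorem IsCylindricQuot.chiArc_arcCone {d : ℕ} {X : Set (ArcQuot d)} (h : IsCylindricQuot X) :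
    chiArc (arcCone X) = (LL - 1) * chiQuot X := by
  have h' : ∃ v, HasMeasureQuot X v := h
  rw [chiQuot, dif_pos h']
  exact h'.choose_spec.arcCone.chiArc_eq

theorem lift_preimage_singleton {d : ℕ} {G : Type*} [Zero G] (ψ : ArcQuot d → G) {a : G}
    (ha : a ≠ 0) : lift ψ ⁻¹' {a} = arcCone (ψ ⁻¹' {a}) := by
  ext φ
  by_cases h : φ = 0
  · have h1 : lift ψ φ = 0 := dif_neg (not_not.2 h)
    constructor
    · intro h2
      exact (ha (h2.symm.trans h1)).elim
    · rintro ⟨h2, -⟩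
      exact (h2 h).elim
  · have h1 : lift ψ φ = ψ (arcProj ⟨φ, h⟩) := dif_pos h
    constructor
    · intro h2
      exact ⟨h, h1.symm.trans h2⟩
    · rintro ⟨_, h2⟩
      exact h1.trans h2

theorem HasIntegral.lift {d : ℕ} {G M : Type*} [AddCommGroup G] [AddCommGroup M] [Module K0Loc M]
    [TopologicalSpace M] [ContinuousConstSMul K0Loc M] {ι : G →+ M} {ψ : ArcQuot d → G}
    (hψ : IsConstructibleFun IsCylindricQuot ψ) {I : M} (hI : HasIntegral chiQuot ι ψ I) :
    HasIntegral chiArc ι (lift ψ) ((LL - 1) • I) := by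
  have h := HasSum.const_smul (LL - 1) hI
  unfold HasIntegral
  convert h using 2 with a
  rw [lift_preimage_singleton ψ a.2, (hψ.2 a.1 a.2).chiArc_arcCone, mul_smul]

end MotivicArcs

end

theorem proposition1 (d : ℕ) {G M : Type*} [AddCommGroup G]
    [AddCommGroup M] [Module MotivicArcs.K0Loc M]
    [TopologicalSpace M] [ContinuousConstSMul MotivicArcs.K0Loc M]
    (ι : G →+ M) (ψ : MotivicArcs.ArcQuot d → G)
    (hψ : MotivicArcs.IntegrableQuot ι ψ) :
    MotivicArcs.IntegrableArc ι (MotivicArcs.lift ψ) ∧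
      ∀ I : M, MotivicArcs.HasIntegral MotivicArcs.chiQuot ι ψ I →
        MotivicArcs.HasIntegral MotivicArcs.chiArc ι (MotivicArcs.lift ψ)
          ((MotivicArcs.LL - 1) • I) := by
  obtain ⟨hc, I, hI⟩ := hψ
  refine ⟨⟨⟨?_, fun a ha => ?_⟩, _, hI.lift hc⟩, fun J hJ => hJ.lift hc⟩
  -- The value 0 at the constant arc may be absent from the range of `ψ`.
  · refine (hc.1.union (Set.countable_singleton 0)).mono ?_
    rintro _ ⟨φ, rfl⟩
    by_cases h : φ = 0
    · exact Or.inr (dif_neg (not_not.2 h))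
    · exact Or.inl ⟨MotivicArcs.arcProj ⟨φ, h⟩, (dif_pos h : MotivicArcs.lift ψ φ = _).symm⟩
  · obtain ⟨v, hv⟩ := hc.2 a ha
    rw [MotivicArcs.lift_preimage_singleton ψ ha]
    exact ⟨_, hv.arcCone⟩
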